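/- Let $f:\mathbb{Z}_n^2\to\mathbb{Z}_n$ be a $2$-neighbor rule with state space $\mathbb{Z}_n=\{0,\dots,n-1\}$. It acts on configurations $\xi\in\mathbb{Z}_n^{\mathbb{Z}}$ by $\xi_{t+1}(x)=f(\xi_t(x-1),\xi_t(x))$. A configuration $\xi_0$ is a periodic solution of $f$ with temporal period $\tau$ and spatial period $\sigma$ if $\sigma$ is the smallest positive integer with $\xi_0(x+\sigma)=\xi_0(x)$ for all $x\in\mathbb{Z}$, and $\tau$ is the smallest positive integer with $\xi_\tau=\xi_0$. A configuration $\eta_0$ is proper for $\xi_0$ if for some $y\in\mathbb{Z}$ it agrees with $\xi_0$ at all $x\le y$. With $\xi_t,\eta_t$ the configurations at time $t$, put $$s_t(\eta_0)=\sup\{x\in\mathbb{Z}:\eta_t(y)=\xi_t(y)\text{ for all }y\le x\}\in\mathbb{Z}\cup\{+\infty\},\qquad v(\eta_0)=\liminf_{t\to\infty}\frac{s_t(\eta_0)}{t}.$$ The periodic solution is weakly robust if $\inf\{v(\eta_0):\eta_0\text{ is proper for }\xi_0\}>0$. Let $\mathcal{T},\Sigma\subset\{1,2,\dots\}$ be fixed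 finite sets such that $\sigma\mid\tau$ for some $(\tau,\sigma)\in\mathcal{T}\times\Sigma$. Let $p_n$ be the probability that a rule chosen uniformly at random from all $n^{n^2}$ $n$-state $2$-neighbor rules has a weakly robust periodic solution whose temporal period $\tau$ and spatial period $\sigma$ satisfy $(\tau,\sigma)\in\mathcal{T}\times\Sigma$. Then there is a constant $c=c(\mathcal{T},\Sigma)>0$, depending only on $\mathcal{T}$ and $\Sigma$, such that $$p_n=\frac{c}{n}+o\Big(\frac1n\Big)\qquad\text{as }n\to\infty .$$ -/

import Mathlib

open Filter Asymptotics ProbabilityTheory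

/-- A `2`-neighbor rule with `n` states. -/
abbrev CARule (n : ℕ) : Type := Fin n × Fin n → Fin n

/-- A global configuration on `ℤ` with `n` states. -/
abbrev CAConfig (n : ℕ) : Type := ℤ → Fin n

/-- One step of the cellular automaton: the new state at `x` is determined by the old states at
`x - 1` and `x`. -/
def CARule.step {n : ℕ} (f : CARule n) (ξ : CAConfig n) : CAConfig n :=
  fun x => f (ξ (x - 1), ξ x)

/-- The configuration `ξ_t` obtained from `ξ_0 = ξ` by running the rule `f` for `t` steps. -/
def CARule.evolve {n : ℕ} (f : CARule n) (ξ : CAConfig n) (t : ℕ) : CAConfig n :=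
  f.step^[t] ξ

/-- `ξ` is a configuration of a periodic solution of `f` with temporal period `τ` and spatial
period `σ`, both positive and minimal. -/
def IsPeriodicSolution {n : ℕ} (f : CARule n) (τ σ : ℕ) (ξ : CAConfig n) : Prop :=
  IsLeast {s : ℕ | 0 < s ∧ ∀ x : ℤ, ξ x = ξ (x + s)} σ ∧
    IsLeast {t : ℕ | 0 < t ∧ f.evolve ξ t = ξ} τ

/-- `η` is proper for `ξ`: they agree on some left half-line. -/
def IsProper {n : ℕ} (ξ η : CAConfig n) : Prop :=
  ∃ y : ℤ, ∀ x ≤ y, η x = ξ x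

/-- The front `s_t(η)`: the supremum of all sites `x` up to which (that is, on `(-∞, x]`) the
configurations `η_t` and `ξ_t` agree. It is `⊤` if they agree everywhere. -/
noncomputable def front {n : ℕ} (f : CARule n) (ξ η : CAConfig n) (t : ℕ) : EReal :=
  ⨆ x ∈ {x : ℤ | ∀ y ≤ x, f.evolve η t y = f.evolve ξ t y}, ((x : ℝ) : EReal)

/-- The expansion velocity in the initial environment `η`. -/
noncomputable def velocityIn {n : ℕ} (f : CARule n) (ξ η : CAConfig n) : EReal :=
  liminf (fun t : ℕ => front f ξ η t / ((t : ℝ) : EReal)) atTop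

/-- The expansion velocity: the infimum over all proper initial environments. -/
noncomputable def expansionVelocity {n : ℕ} (f : CARule n) (ξ : CAConfig n) : EReal :=
  ⨅ η ∈ {η : CAConfig n | IsProper ξ η}, velocityIn f ξ η

/-- The configurations of weakly robust periodic solutions of `f` whose temporal period is in `T`
and whose spatial period is in `S`. -/
def WRPS {n : ℕ} (f : CARule n) (T S : Finset ℕ) : Set (CAConfig n) :=
  {ξ | ∃ τ ∈ T, ∃ σ ∈ S, IsPeriodicSolution f τ σ ξ ∧ 0 < expansionVelocity f ξ}

/-- The probability that a uniformly random `n`-state rule has a weakly robust periodic solution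
with periods in `T × S`. -/
noncomputable def probWRPS (T S : Finset ℕ) (n : ℕ) : ℝ :=
  (uniformOn (Set.univ : Set (CARule n))).real {f | (WRPS f T S).Nonempty}

/-! The states that a site takes over time drive a walk on `Fin n` at the next site. If the velocity
is positive, every such walk meets the actual next column
(`exists_walk_eq_of_expansionVelocity_pos`); conversely, a uniform bound on the meeting times gives
positive velocity (`expansionVelocity_pos_of_walk`). Weak robustness thus becomes a statement about
finitely many values of the rule.

The main contribution comes from solutions `ξ_t(x) = b(t + x m)`, with `b` an injective cycle
indexed by `ZMod τ` and `m` of additive order `σ`. For fixed `b`, compatibility prescribes `τ`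
values of the rule, and independently all walks must join the cycle. The indicator of joining is
`det (1 - M)`, where `M` is the transition matrix of the nodes off the cycle. Its rows are
independent, so by multilinearity the average is the determinant of the averaged matrix, which
reduces to `1 - (1 - 1/n)^τ` (`card_joinsRoots`). There are about `n^τ / τ` cycles up to rotation,
so each type `(τ, m)` has expected count `~ 1/n` (`tendsto_goodCycle`). The constant `c` is the
number of types with `τ ∈ T` and order of `m` in `S`.

All other configurations cost `o(1/n)` (`tendsto_exceptional`). A pattern with more adjacent pairs
than states loses a factor `1/n` through the extra prescribed value, and joining still has
probability `o(1)`, because a walk started outside the pattern usually closes up before it hits a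
bounded set (`card_absorbed_le`). A pattern with two columns of pairwise distinct states has joining
probability `O(1/n²)`. A tile in neither class is generated by a good cycle
(`exists_goodCycle_or_isExceptional`), and two good cycles for one rule are rotations of each other
or form an exceptional labelling (`card_mul_card_le`). A first moment upper bound and a second
moment lower bound then agree to order `1/n` (`probWRPS_bounds`). -/

/-! ### Walks along a column -/

/-- The evolution of a single site whose left neighbor goes through the states `w 0, w 1, …`. -/
def walk {n : ℕ} (f : CARule n) (w : ℕ → Fin n) (z : Fin n) : ℕ → Fin n
  | 0 => z
  | t + 1 => f (w t, walk f w z t)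

theorem walk_add {n : ℕ} (f : CARule n) (w : ℕ → Fin n) (z : Fin n) (s t : ℕ) :
    walk f w z (s + t) = walk f (fun i => w (s + i)) (walk f w z s) t := by
  induction t with
  | zero => rfl
  | succ t ih => rw [← add_assoc]; simp only [walk, ih]

theorem evolve_succ_apply {n : ℕ} (f : CARule n) (ξ : CAConfig n) (t : ℕ) (x : ℤ) :
    f.evolve ξ (t + 1) x = f (f.evolve ξ t (x - 1), f.evolve ξ t x) := by
  simp only [CARule.evolve, Function.iterate_succ_apply', CARule.step]

theorem evolve_eq_walk {n : ℕ} (f : CARule n) (ξ : CAConfig n) (x : ℤ) (s t : ℕ) :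
    f.evolve ξ (s + t) (x + 1) =
      walk f (fun i => f.evolve ξ (s + i) x) (f.evolve ξ s (x + 1)) t := by
  induction t with
  | zero => rfl
  | succ t ih =>
    rw [← add_assoc, evolve_succ_apply, ih, add_sub_cancel_right]
    rfl

/-- Influence travels only to the right, because a site reads itself and its left neighbor. -/
theorem evolve_eq_of_le {n : ℕ} (f : CARule n) {ξ η : CAConfig n} {x : ℤ} {s : ℕ}
    (h : ∀ y ≤ x, f.evolve η s y = f.evolve ξ s y) (t : ℕ) :
    ∀ y ≤ x, f.evolve η (s + t) y = f.evolve ξ (s + t) y := by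
  induction t with
  | zero => simpa using h
  | succ t ih =>
    intro y hy
    rw [← add_assoc, evolve_succ_apply, evolve_succ_apply, ih y hy, ih (y - 1) (by omega)]

/-- In a weakly robust solution every walk along a column joins the column to its right. -/
theorem exists_walk_eq_of_expansionVelocity_pos {n : ℕ} {f : CARule n} {ξ : CAConfig n}
    (h : 0 < expansionVelocity f ξ) (x : ℤ) (z : Fin n) :
    ∃ t, walk f (fun i => f.evolve ξ i x) z t = f.evolve ξ t (x + 1) := by
  by_contra! hne
  -- If the walk from `z` never joins, replacing everything to the right of `x` by `z` freezes the
  -- front at `x`, so the velocity is zero.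
  set η : CAConfig n := fun y => if y ≤ x then ξ y else z with hη
  have hagree : ∀ t, ∀ y ≤ x, f.evolve η t y = f.evolve ξ t y := by
    intro t
    have := evolve_eq_of_le f (ξ := ξ) (η := η) (x := x) (s := 0)
      (fun y hy => by simp [CARule.evolve, hη, hy]) t
    simpa using this
  have hx1 : ∀ t, f.evolve η t (x + 1) = walk f (fun i => f.evolve ξ i x) z t := by
    intro t
    have := evolve_eq_walk f η x 0 t
    simp only [zero_add] at this
    rw [this]
    have h0 : f.evolve η 0 (x + 1) = z := by simp [CARule.evolve, hη]
    rw [h0]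
    congr 1
    funext i
    exact hagree i x le_rfl
  have hfront : ∀ t, front f ξ η t = ((x : ℝ) : EReal) := by
    intro t
    apply le_antisymm
    · refine iSup₂_le fun y hy => ?_
      have : y ≤ x := by
        by_contra hlt
        exact hne t (by rw [← hx1]; exact hy (x + 1) (by omega))
      exact_mod_cast this
    · exact le_iSup₂_of_le x (hagree t) le_rfl
  have hv : velocityIn f ξ η = 0 := by
    have ht : Tendsto (fun t : ℕ => front f ξ η t / ((t : ℝ) : EReal)) atTop (nhds 0) := by
      simp only [hfront, ← EReal.coe_div]
      exact EReal.tendsto_coe.2 (tendsto_const_div_atTop_nhds_zero_nat (x : ℝ))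
    exact ht.liminf_eq
  have : expansionVelocity f ξ ≤ velocityIn f ξ η :=
    iInf₂_le η (show IsProper ξ η from ⟨x, fun y hy => by simp [hη, hy]⟩)
  rw [hv] at this
  exact absurd h (not_lt.2 this)

/-- If all walks along all columns join the next column within a bounded time, then the expansion
velocity is positive. -/
theorem expansionVelocity_pos_of_walk {n : ℕ} {f : CARule n} {ξ : CAConfig n} {K : ℕ}
    (hK : 0 < K)
    (h : ∀ (x : ℤ) (s : ℕ) (z : Fin n), ∃ t ≤ K,
      walk f (fun i => f.evolve ξ (s + i) x) z t = f.evolve ξ (s + t) (x + 1)) :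
    0 < expansionVelocity f ξ := by
  have hKpos : (0 : ℝ) < K := by exact_mod_cast hK
  -- The front gains a site every `K` steps; half of this rate absorbs the starting point `y` and
  -- the rounding of `t / K`.
  have key : ((1 / (2 * K) : ℝ) : EReal) ≤ expansionVelocity f ξ := by
    refine le_iInf₂ fun η hη => ?_
    obtain ⟨y, hy⟩ := hη
    have hadv : ∀ k : ℕ, ∀ y' ≤ y + k, f.evolve η (k * K) y' = f.evolve ξ (k * K) y' := by
      intro k
      induction k with
      | zero => simpa [CARule.evolve] using hy
      | succ k ih =>
        intro y' hy'
        have hle := evolve_eq_of_le f ih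
        rcases (show y' ≤ y + k ∨ y' = y + k + 1 by push_cast at hy'; omega) with hlt | heq
        · rw [Nat.succ_mul]; exact hle K y' hlt
        · obtain ⟨t, htK, ht⟩ := h (y + k) (k * K) (f.evolve η (k * K) (y + k + 1))
          have h1 : ∀ i, f.evolve η (k * K + i) (y + k) = f.evolve ξ (k * K + i) (y + k) :=
            fun i => hle i _ le_rfl
          have h2 : f.evolve η (k * K + t) (y + k + 1) = f.evolve ξ (k * K + t) (y + k + 1) := by
            rw [evolve_eq_walk, ← ht]
            simp only [h1]
          have h3 : ∀ w ≤ y + k + 1, f.evolve η (k * K + t) w = f.evolve ξ (k * K + t) w := by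
            intro w hw
            rcases hw.lt_or_eq with hw | rfl
            · exact hle t w (by omega)
            · exact h2
          have h4 := evolve_eq_of_le f h3 (K - t) y' (by omega)
          rw [add_assoc, Nat.add_sub_cancel' htK] at h4
          rwa [Nat.succ_mul]
    have hfront : ∀ t : ℕ, (((y + (t / K : ℕ) : ℤ) : ℝ) : EReal) ≤ front f ξ η t := by
      intro t
      refine le_iSup₂_of_le (y + (t / K : ℕ)) ?_ le_rfl
      have := evolve_eq_of_le f (hadv (t / K)) (t % K)
      rwa [Nat.div_add_mod'] at this
    refine le_liminf_of_le (by isBoundedDefault) ?_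
    have hlim : Tendsto (fun t : ℕ => (t : ℝ)) atTop atTop := tendsto_natCast_atTop_atTop
    filter_upwards [hlim.eventually_ge_atTop (2 * K * (1 - y)), eventually_gt_atTop 0]
      with t ht ht0
    have ht0' : (0 : ℝ) < t := by exact_mod_cast ht0
    have h1 : (((y + (t / K : ℕ) : ℤ) : ℝ) / t : ℝ) ≤ front f ξ η t / ((t : ℝ) : EReal) := by
      rw [EReal.coe_div]
      exact EReal.div_le_div_right_of_nonneg (by exact_mod_cast ht0'.le) (hfront t)
    refine le_trans ?_ h1
    rw [EReal.coe_le_coe_iff, div_le_div_iff₀ (by positivity) ht0']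
    have h2 : (t : ℝ) / K ≤ (t / K : ℕ) + 1 := (Nat.lt_floor_add_one ((t : ℝ) / K)).le.trans
      (by rw [Nat.floor_div_eq_div])
    rw [div_le_iff₀ hKpos] at h2
    rw [Int.cast_add, Int.cast_natCast]
    nlinarith
  refine lt_of_lt_of_le ?_ key
  exact_mod_cast (by positivity : (0 : ℝ) < 1 / (2 * K))

/-! ### Resampling uniformly random functions -/

section Resample

variable {D R : Type*} [DecidableEq D] [Fintype R]

/-- Resampling a function at an adaptively chosen point preserves the uniform distribution. -/
theorem card_mul_sum_eq_sum_update (A : Finset (D → R)) (q : (D → R) → D)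
    (hA : ∀ f ∈ A, ∀ v, Function.update f (q f) v ∈ A)
    (hq : ∀ f ∈ A, ∀ v, q (Function.update f (q f) v) = q f) (G : (D → R) → ℝ) :
    (Fintype.card R : ℝ) * ∑ f ∈ A, G f = ∑ f ∈ A, ∑ v, G (Function.update f (q f) v) := by
  have h1 : (Fintype.card R : ℝ) * ∑ f ∈ A, G f = ∑ p ∈ A ×ˢ (Finset.univ : Finset R), G p.1 := by
    rw [Finset.sum_product, Finset.mul_sum]
    simp
  rw [h1, ← Finset.sum_product']
  symm
  -- This map is an involution: it exchanges the stored value with the value of the function at the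
  -- queried point.
  refine Finset.sum_nbij' (fun p => (Function.update p.1 (q p.1) p.2, p.1 (q p.1)))
    (fun p => (Function.update p.1 (q p.1) p.2, p.1 (q p.1))) ?_ ?_ ?_ ?_ ?_
  · rintro ⟨f, v⟩ hp
    simp only [Finset.mem_product, Finset.mem_univ, and_true] at hp ⊢
    exact hA f hp v
  · rintro ⟨f, v⟩ hp
    simp only [Finset.mem_product, Finset.mem_univ, and_true] at hp ⊢
    exact hA f hp v
  · rintro ⟨f, v⟩ hp
    simp only [Finset.mem_product, Finset.mem_univ, and_true] at hp ⊢
    simp [hq f hp v]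
  · rintro ⟨f, v⟩ hp
    simp only [Finset.mem_product, Finset.mem_univ, and_true] at hp ⊢
    simp [hq f hp v]
  · rintro ⟨f, v⟩ hp
    rfl

variable [Fintype D]

/-- The values of a uniformly random function on the range of an embedding are independent of
every event that does not depend on them. -/
theorem sum_comp_mul_card_pow {D' : Type*} [Fintype D'] [DecidableEq D'] (ι : D' → D)
    (hι : Function.Injective ι)
    (C : (D → R) → Prop) [DecidablePred C]
    (hC : ∀ f g, C f → C (Function.extend ι g f)) (F : (D' → R) → ℝ) :
    (∑ f with C f, F (f ∘ ι)) * (Fintype.card R : ℝ) ^ Fintype.card D' =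
      (Finset.univ.filter C).card * ∑ g, F g := by
  have h1 : (∑ f with C f, F (f ∘ ι)) * (Fintype.card R : ℝ) ^ Fintype.card D' =
      ∑ p ∈ (Finset.univ.filter C) ×ˢ (Finset.univ : Finset (D' → R)), F (p.1 ∘ ι) := by
    rw [Finset.sum_product, Finset.sum_mul]
    simp [mul_comm]
  have h2 : ((Finset.univ.filter C).card : ℝ) * ∑ g, F g =
      ∑ p ∈ (Finset.univ.filter C) ×ˢ (Finset.univ : Finset (D' → R)), F p.2 := by
    rw [Finset.sum_product]
    simp
  have hext : ∀ (f : D → R) (g : D' → R),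
      Function.extend ι (f ∘ ι) (Function.extend ι g f) = f := by
    intro f g
    funext d
    by_cases hd : ∃ d', ι d' = d
    · obtain ⟨d', rfl⟩ := hd
      simp [hι.extend_apply]
    · simp [Function.extend_apply', hd]
  rw [h1, h2]
  refine Finset.sum_nbij' (fun p => (Function.extend ι p.2 p.1, p.1 ∘ ι))
    (fun p => (Function.extend ι p.2 p.1, p.1 ∘ ι)) ?_ ?_ ?_ ?_ ?_
  · rintro ⟨f, g⟩ hp
    simp only [Finset.mem_product, Finset.mem_univ, and_true, Finset.mem_filter, true_and] at hp ⊢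
    exact hC f g hp
  · rintro ⟨f, g⟩ hp
    simp only [Finset.mem_product, Finset.mem_univ, and_true, Finset.mem_filter, true_and] at hp ⊢
    exact hC f g hp
  · rintro ⟨f, g⟩ hp
    simp [hext, Function.extend_comp hι]
  · rintro ⟨f, g⟩ hp
    simp [hext, Function.extend_comp hι]
  · rintro ⟨f, g⟩ hp
    rfl

/-- The number of functions with prescribed values at distinct points. -/
theorem card_filter_comp_eq {D' : Type*} [Fintype D'] [DecidableEq D'] [DecidableEq R]
    (ι : D' → D) (hι : Function.Injective ι) (v : D' → R) :
    ((Finset.univ.filter fun f : D → R => f ∘ ι = v).card : ℝ) *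
      (Fintype.card R : ℝ) ^ Fintype.card D' = (Fintype.card R : ℝ) ^ Fintype.card D := by
  have := sum_comp_mul_card_pow (R := R) ι hι (fun _ => True) (fun _ _ h => h)
    (fun g => if g = v then 1 else 0)
  simp only [Finset.filter_true, Finset.sum_ite_eq', Finset.mem_univ, if_true, mul_one,
    Finset.card_univ, Fintype.card_fun] at this
  rw [← Nat.cast_pow (Fintype.card R) (Fintype.card D), ← this]
  simp

/-- An upper bound for the number of functions with prescribed values at points that need not be
distinct. -/
theorem card_filter_forall_le {I : Type*} [Fintype I] [DecidableEq R] (d : I → D) (v : I → R) :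
    ((Finset.univ.filter fun f : D → R => ∀ i, f (d i) = v i).card : ℝ) *
      (Fintype.card R : ℝ) ^ (Finset.univ.image d).card ≤
        (Fintype.card R : ℝ) ^ Fintype.card D := by
  classical
  have hsec : ∀ e : {e // e ∈ Finset.univ.image d}, ∃ i, d i = e.1 := fun e => by
    obtain ⟨i, -, hi⟩ := Finset.mem_image.1 e.2
    exact ⟨i, hi⟩
  choose sec hsec using hsec
  have h := card_filter_comp_eq (R := R) (fun e : {e // e ∈ Finset.univ.image d} => e.1)
    Subtype.val_injective (fun e => v (sec e))
  rw [Fintype.card_coe] at h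
  rw [← h]
  gcongr with f
  intro hf
  funext e
  simp only [Function.comp_apply]
  rw [← hsec e, hf]

end Resample

/-! ### A random walk along a periodic column is unlikely to be absorbed by a small set -/

section Absorption

variable {n : ℕ}

/-- The argument of the rule that is used by the walk at time `t`. -/
def query (w : ℕ → Fin n) (y : Fin n) (f : CARule n) (t : ℕ) : Fin n × Fin n :=
  (w t, walk f w y t)

/-- The walk uses a new argument of the rule at time `t`. -/
def Fresh (w : ℕ → Fin n) (y : Fin n) (f : CARule n) (t : ℕ) : Prop :=
  ∀ s < t, query w y f s ≠ query w y f t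

/-- Until time `t` the walk has neither met `B` nor repeated a state in the same phase. -/
def Alive (B : Finset (Fin n)) (w : ℕ → Fin n) (y : Fin n) (τ : ℕ) (f : CARule n) (t : ℕ) : Prop :=
  (∀ s ≤ t, walk f w y s ∉ B) ∧
    ∀ s ≤ t, ∀ s' < s, s' ≡ s [MOD τ] → walk f w y s' ≠ walk f w y s

open Classical in
/-- The number of fresh steps of the walk in the time interval `[k, t)`. -/
noncomputable def freshCount (w : ℕ → Fin n) (y : Fin n) (k : ℕ) (f : CARule n) (t : ℕ) : ℕ :=
  ((Finset.Ico k t).filter (Fresh w y f)).card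

variable {B : Finset (Fin n)} {w : ℕ → Fin n} {y : Fin n} {τ : ℕ} {f : CARule n} {t : ℕ}

theorem Alive.mono {s : ℕ} (h : Alive B w y τ f t) (hs : s ≤ t) : Alive B w y τ f s :=
  ⟨fun r hr => h.1 r (hr.trans hs), fun r hr => h.2 r (hr.trans hs)⟩

/-- A fresh argument has not been read before time `t`, so changing the value there cannot affect
the past of the walk. -/
theorem walk_update (hf : Fresh w y f t) (v : Fin n) {s : ℕ} (hs : s ≤ t) :
    walk (Function.update f (query w y f t) v) w y s = walk f w y s := by
  induction s with
  | zero => rfl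
  | succ s ih =>
    simp only [walk, ih (by omega)]
    exact Function.update_of_ne (hf s (by omega)) _ _

theorem query_update (hf : Fresh w y f t) (v : Fin n) {s : ℕ} (hs : s ≤ t) :
    query w y (Function.update f (query w y f t) v) s = query w y f s :=
  congrArg (Prod.mk (w s)) (walk_update hf v hs)

theorem walk_update_succ (hf : Fresh w y f t) (v : Fin n) :
    walk (Function.update f (query w y f t) v) w y (t + 1) = v := by
  change Function.update f (query w y f t) v
    (query w y (Function.update f (query w y f t) v) t) = v
  rw [query_update hf v le_rfl, Function.update_self]

theorem fresh_update (hf : Fresh w y f t) (v : Fin n) {s : ℕ} (hs : s ≤ t) :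
    Fresh w y (Function.update f (query w y f t) v) s ↔ Fresh w y f s := by
  unfold Fresh
  refine forall₂_congr fun r hr => ?_
  rw [query_update hf v hs, query_update hf v (hr.le.trans hs)]

theorem alive_update (hf : Fresh w y f t) (v : Fin n) {s : ℕ} (hs : s ≤ t) :
    Alive B w y τ (Function.update f (query w y f t) v) s ↔ Alive B w y τ f s := by
  unfold Alive
  refine and_congr (forall₂_congr fun r hr => ?_)
    (forall₂_congr fun r hr => forall₂_congr fun r' hr' => ?_)
  · rw [walk_update hf v (hr.trans hs)]
  · rw [walk_update hf v (hr.trans hs), walk_update hf v (hr'.le.trans (hr.trans hs))]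

theorem freshCount_update (hf : Fresh w y f t) (v : Fin n) (k : ℕ) {s : ℕ} (hs : s ≤ t + 1) :
    freshCount w y k (Function.update f (query w y f t) v) s = freshCount w y k f s := by
  classical
  unfold freshCount
  congr 1
  refine Finset.filter_congr fun r hr => fresh_update hf v ?_
  have := (Finset.mem_Ico.1 hr).2
  omega

theorem freshCount_succ (k : ℕ) (hk : k ≤ t) (hf : Fresh w y f t) :
    freshCount w y k f (t + 1) = freshCount w y k f t + 1 := by
  classical
  unfold freshCount
  rw [← Finset.insert_Ico_right_eq_Ico_add_one hk, Finset.filter_insert, if_pos hf,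
    Finset.card_insert_of_notMem (by simp)]

theorem freshCount_succ_of_not (k : ℕ) (h : t < k ∨ ¬ Fresh w y f t) :
    freshCount w y k f (t + 1) = freshCount w y k f t := by
  classical
  unfold freshCount
  rcases lt_or_ge t k with hk | hk
  · rw [Finset.Ico_eq_empty (by omega), Finset.Ico_eq_empty (by omega)]
  · rw [← Finset.insert_Ico_right_eq_Ico_add_one hk, Finset.filter_insert, if_neg]
    rcases h with h | h
    · omega
    · exact h

/-- A long walk without repetitions has many fresh steps: every state but the first is reached for
the first time by a fresh step. -/
theorem le_freshCount (hτ : 0 < τ) {k : ℕ} (h : Alive B w y τ f (2 * τ * k)) :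
    k - 1 ≤ freshCount w y k f (2 * τ * k) := by
  classical
  set N := 2 * τ * k
  have hinj : Set.InjOn (fun i => (i % τ, walk f w y i)) (Finset.range N) := by
    intro i hi j hj hij
    simp only [Finset.coe_range, Set.mem_Iio] at hi hj
    simp only [Prod.mk.injEq] at hij
    rcases lt_trichotomy i j with hlt | heq | hgt
    · exact absurd hij.2 (h.2 j hj.le i hlt hij.1)
    · exact heq
    · exact absurd hij.2.symm (h.2 i hi.le j hgt hij.1.symm)
  have hcard : N ≤ τ * ((Finset.range N).image (walk f w y)).card := by
    calc N = ((Finset.range N).image (fun i => (i % τ, walk f w y i))).card := by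
          rw [Finset.card_image_of_injOn hinj, Finset.card_range]
      _ ≤ (Finset.range τ ×ˢ (Finset.range N).image (walk f w y)).card := by
          refine Finset.card_le_card fun p hp => ?_
          obtain ⟨i, hi, rfl⟩ := Finset.mem_image.1 hp
          exact Finset.mem_product.2
            ⟨Finset.mem_range.2 (Nat.mod_lt _ hτ), Finset.mem_image_of_mem _ hi⟩
      _ = _ := by rw [Finset.card_product, Finset.card_range]
  -- A state occurs at most once per phase, so `2τk` steps show at least `2k` states. Leaving out
  -- the first state and the fresh steps before time `k` still leaves `k - 1`.
  have h2k : 2 * k ≤ ((Finset.range N).image (walk f w y)).card := by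
    refine Nat.le_of_mul_le_mul_left (c := τ) ?_ hτ
    calc τ * (2 * k) = N := by simp only [N]; ring
      _ ≤ _ := hcard
  have hsub : (Finset.range N).image (walk f w y) ⊆
      insert y (((Finset.range N).filter (Fresh w y f)).image fun i => walk f w y (i + 1)) := by
    intro z hz
    obtain ⟨i, hi, hiz⟩ := Finset.mem_image.1 hz
    have hex : ∃ i, walk f w y i = z := ⟨i, hiz⟩
    have hle : Nat.find hex ≤ i := Nat.find_min' hex hiz
    have hspec := Nat.find_spec hex
    rcases Nat.eq_zero_or_eq_succ_pred (Nat.find hex) with h0 | h1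
    · rw [h0] at hspec
      exact Finset.mem_insert.2 (Or.inl hspec.symm)
    · set j := (Nat.find hex).pred
      rw [h1] at hspec hle
      refine Finset.mem_insert_of_mem (Finset.mem_image.2 ⟨j, ?_, hspec⟩)
      rw [Finset.mem_range] at hi
      refine Finset.mem_filter.2 ⟨Finset.mem_range.2 (by omega), fun s hs heq => ?_⟩
      have hw : walk f w y (s + 1) = z := by
        rw [← hspec]
        exact congrArg f heq
      exact Nat.find_min hex (by omega) hw
  have hle := (Finset.card_le_card hsub).trans (Finset.card_insert_le _ _)
  have himg := Finset.card_image_le (s := (Finset.range N).filter (Fresh w y f))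
    (f := fun i => walk f w y (i + 1))
  have hsplit : ((Finset.range N).filter (Fresh w y f)).card ≤ k + freshCount w y k f N := by
    unfold freshCount
    calc ((Finset.range N).filter (Fresh w y f)).card
        ≤ (Finset.range k ∪ (Finset.Ico k N).filter (Fresh w y f)).card := by
          refine Finset.card_le_card fun i hi => ?_
          simp only [Finset.mem_filter, Finset.mem_range, Finset.mem_union, Finset.mem_Ico] at hi ⊢
          rcases lt_or_ge i k with hk | hk
          · exact Or.inl hk
          · exact Or.inr ⟨⟨hk, hi.1⟩, hi.2⟩
      _ ≤ _ := by
          refine (Finset.card_union_le _ _).trans ?_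
          rw [Finset.card_range]
  omega

/-- Among the values of the rule at a fresh argument, at least `l` lead to a repetition. -/
theorem card_alive_update_le {l : ℕ} (hf : Fresh w y f t) (h : Alive B w y τ f t) (hτ : 0 < τ)
    (hl : τ * l ≤ t) (S : Finset (Fin n))
    (hS : ∀ v ∈ S, Alive B w y τ (Function.update f (query w y f t) v) (t + 1)) :
    S.card + l ≤ n := by
  classical
  have hbound : ∀ i < l, τ * (i + 1) ≤ t := fun i hi =>
    (Nat.mul_le_mul_left τ (by omega)).trans hl
  -- These are the `l` states most recently seen in the phase of time `t + 1`; each of them would be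
  -- a repetition.
  set V := (Finset.range l).image fun i => walk f w y (t + 1 - τ * (i + 1)) with hV
  have hmod : ∀ i < l, t + 1 - τ * (i + 1) ≡ t + 1 [MOD τ] := by
    intro i hi
    have h1 := hbound i hi
    have : t + 1 = (t + 1 - τ * (i + 1)) + τ * (i + 1) := by omega
    conv_rhs => rw [this]
    simp [Nat.ModEq]
  have hVcard : V.card = l := by
    rw [hV, Finset.card_image_of_injOn, Finset.card_range]
    have key : ∀ i < l, ∀ j < l, i < j →
        walk f w y (t + 1 - τ * (i + 1)) ≠ walk f w y (t + 1 - τ * (j + 1)) := by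
      intro i hi j hj hij heq
      have h1 := hbound i hi
      have h2 := hbound j hj
      have h3 : τ * (i + 1) < τ * (j + 1) := Nat.mul_lt_mul_of_pos_left (by omega) hτ
      have h4 : 0 < τ * (i + 1) := by positivity
      exact h.2 _ (by omega) _ (by omega) ((hmod j hj).trans (hmod i hi).symm) heq.symm
    intro i hi j hj hij
    simp only [Finset.coe_range, Set.mem_Iio] at hi hj
    rcases lt_trichotomy i j with hlt | heq | hgt
    · exact absurd hij (key i hi j hj hlt)
    · exact heq
    · exact absurd hij.symm (key j hj i hi hgt)
  have hdisj : Disjoint S V := by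
    rw [Finset.disjoint_left]
    intro v hv hvV
    obtain ⟨i, hi, rfl⟩ := Finset.mem_image.1 hvV
    rw [Finset.mem_range] at hi
    have h1 := hbound i hi
    have h4 : 0 < τ * (i + 1) := by positivity
    have := (hS _ hv).2 (t + 1) le_rfl (t + 1 - τ * (i + 1)) (by omega) (hmod i hi)
    rw [walk_update_succ hf, walk_update hf _ (by omega)] at this
    exact this rfl
  rw [← hVcard, ← Finset.card_union_of_disjoint hdisj]
  simpa using Finset.card_le_univ (S ∪ V)

-- The first entrance into `B` uses a fresh argument, since a repeated one would have led into `B`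
-- before. Resampling the value there hits `B` with probability `B.card / n`.
open Classical in
theorem card_enter_le (C : CARule n → Prop)
    (hC : ∀ f q v, q.2 ∉ B → C f → C (Function.update f q v)) (t : ℕ) :
    (n : ℝ) * (Finset.univ.filter fun f : CARule n =>
      C f ∧ (∀ s ≤ t, walk f w y s ∉ B) ∧ walk f w y (t + 1) ∈ B).card ≤
      B.card * (Finset.univ.filter C).card := by
  set A := Finset.univ.filter fun f : CARule n =>
    C f ∧ (∀ s ≤ t, walk f w y s ∉ B) ∧ Fresh w y f t with hA
  have hfr : ∀ f ∈ A, Fresh w y f t := fun f hf => (Finset.mem_filter.1 hf).2.2.2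
  have hres := card_mul_sum_eq_sum_update A (fun f => query w y f t) ?_ ?_
    (fun f => if walk f w y (t + 1) ∈ B then 1 else 0)
  · rw [Fintype.card_fin] at hres
    have hle : ((Finset.univ.filter fun f : CARule n =>
        C f ∧ (∀ s ≤ t, walk f w y s ∉ B) ∧ walk f w y (t + 1) ∈ B).card : ℝ) ≤
        ∑ f ∈ A, if walk f w y (t + 1) ∈ B then 1 else 0 := by
      rw [← Finset.sum_filter, Finset.sum_const, nsmul_eq_mul, mul_one]
      gcongr
      intro f hf
      simp only [Finset.mem_filter, Finset.mem_univ, true_and, hA] at hf ⊢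
      refine ⟨⟨hf.1, hf.2.1, fun s hs heq => ?_⟩, hf.2.2⟩
      have : walk f w y (s + 1) = walk f w y (t + 1) := congrArg f heq
      exact hf.2.1 (s + 1) hs (this ▸ hf.2.2)
    calc _ ≤ (n : ℝ) * ∑ f ∈ A, (if walk f w y (t + 1) ∈ B then (1 : ℝ) else 0) := by gcongr
      _ = ∑ f ∈ A, ∑ v, if walk (Function.update f (query w y f t) v) w y (t + 1) ∈ B
            then (1 : ℝ) else 0 := hres
      _ = ∑ f ∈ A, (B.card : ℝ) := by
          refine Finset.sum_congr rfl fun f hf => ?_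
          simp [walk_update_succ (hfr f hf)]
      _ ≤ _ := by
          rw [Finset.sum_const, nsmul_eq_mul, mul_comm]
          gcongr
          exact Finset.monotone_filter_right _ fun f _ hf => hf.1
  · intro f hf v
    have hff := hfr f hf
    simp only [Finset.mem_filter, Finset.mem_univ, true_and, hA] at hf ⊢
    refine ⟨hC _ _ _ (hf.2.1 t le_rfl) hf.1, fun s hs => ?_, (fresh_update hff v le_rfl).2 hff⟩
    rw [walk_update hff v hs]
    exact hf.2.1 s hs
  · intro f hf v
    exact query_update (hfr f hf) v le_rfl

open Classical in
/-- Weighted count of the rules that keep the walk alive. -/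
noncomputable def aliveWeight (B : Finset (Fin n)) (w : ℕ → Fin n) (y : Fin n) (τ k : ℕ) (c : ℝ)
    (C : CARule n → Prop) (f : CARule n) (t : ℕ) : ℝ :=
  if C f ∧ Alive B w y τ f t then c ^ freshCount w y k f t else 0

-- A supermartingale estimate. From time `τ * l` on, a fresh step keeps the walk alive with
-- probability at most `(n - l) / n`, which the factor `n / (n - l)` gained by the weight
-- compensates.
open Classical in
theorem sum_aliveWeight_succ_le {l : ℕ} (hτ : 0 < τ) (hln : l < n) (C : CARule n → Prop)
    (hC : ∀ f q v, q.2 ∉ B → C f → C (Function.update f q v)) (t : ℕ) :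
    ∑ f, aliveWeight B w y τ (τ * l) (n / (n - l)) C f (t + 1) ≤
      ∑ f, aliveWeight B w y τ (τ * l) (n / (n - l)) C f t := by
  have hpos : (0 : ℝ) < n - l := by
    have : (l : ℝ) < n := by exact_mod_cast hln
    linarith
  set c : ℝ := n / (n - l) with hc
  have hc0 : 0 ≤ c := by positivity
  have hn : (0 : ℝ) < n := by
    have : (0 : ℝ) ≤ l := by positivity
    linarith
  set A := Finset.univ.filter fun f : CARule n =>
    C f ∧ Alive B w y τ f t ∧ Fresh w y f t with hA
  have hfr : ∀ f ∈ A, Fresh w y f t := fun f hf => (Finset.mem_filter.1 hf).2.2.2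
  have hpt : ∀ f, t < τ * l ∨ f ∉ A →
      aliveWeight B w y τ (τ * l) c C f (t + 1) ≤ aliveWeight B w y τ (τ * l) c C f t := by
    intro f hf
    unfold aliveWeight
    split_ifs with h1 h2 h2
    · rw [freshCount_succ_of_not]
      refine hf.imp_right fun h3 h4 => h3 ?_
      simp only [hA, Finset.mem_filter, Finset.mem_univ, true_and]
      exact ⟨h2.1, h2.2, h4⟩
    · exact absurd ⟨h1.1, h1.2.mono (Nat.le_succ t)⟩ h2
    · positivity
    · exact le_rfl
  rcases lt_or_ge t (τ * l) with htl | htl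
  · exact Finset.sum_le_sum fun f _ => hpt f (Or.inl htl)
  rw [← Finset.sum_add_sum_compl A, ← Finset.sum_add_sum_compl A]
  refine add_le_add ?_ (Finset.sum_le_sum fun f hf => hpt f (Or.inr (Finset.mem_compl.1 hf)))
  have hres := card_mul_sum_eq_sum_update A (fun f => query w y f t) ?_ ?_
    (fun f => aliveWeight B w y τ (τ * l) c C f (t + 1))
  · rw [Fintype.card_fin] at hres
    refine le_of_mul_le_mul_left ?_ hn
    rw [hres, Finset.mul_sum]
    refine Finset.sum_le_sum fun f hf => ?_
    have hff := hfr f hf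
    have hf' := (Finset.mem_filter.1 hf).2
    have hw : aliveWeight B w y τ (τ * l) c C f t = c ^ freshCount w y (τ * l) f t := by
      rw [aliveWeight, if_pos ⟨hf'.1, hf'.2.1⟩]
    set S := Finset.univ.filter fun v =>
      Alive B w y τ (Function.update f (query w y f t) v) (t + 1) with hS
    have hSl := card_alive_update_le hff hf'.2.1 hτ htl S
      (fun v hv => (Finset.mem_filter.1 hv).2)
    have hSl' : (S.card : ℝ) ≤ n - l := by
      have : (S.card : ℝ) + l ≤ n := by exact_mod_cast hSl
      linarith
    calc ∑ v, aliveWeight B w y τ (τ * l) c C (Function.update f (query w y f t) v) (t + 1)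
        ≤ ∑ v, if v ∈ S then c ^ (freshCount w y (τ * l) f t + 1) else 0 := by
          refine Finset.sum_le_sum fun v _ => ?_
          unfold aliveWeight
          rw [freshCount_update hff v _ le_rfl, freshCount_succ _ htl hff]
          split_ifs with h1 h2 h2
          · exact le_rfl
          · exact absurd (show v ∈ S from Finset.mem_filter.2 ⟨Finset.mem_univ v, h1.2⟩) h2
          · positivity
          · exact le_rfl
      _ = S.card * c ^ (freshCount w y (τ * l) f t + 1) := by simp
      _ ≤ (n - l) * c ^ (freshCount w y (τ * l) f t + 1) := by gcongr
      _ = n * aliveWeight B w y τ (τ * l) c C f t := by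
          rw [hw, pow_succ, hc]
          field_simp
  · intro f hf v
    have hff := hfr f hf
    simp only [Finset.mem_filter, Finset.mem_univ, true_and, hA] at hf ⊢
    exact ⟨hC _ _ _ (hf.2.1.1 t le_rfl) hf.1, (alive_update hff v le_rfl).2 hf.2.1,
      (fresh_update hff v le_rfl).2 hff⟩
  · intro f hf v
    exact query_update (hfr f hf) v le_rfl

-- Markov's inequality for the supermartingale: a walk alive at the final time has at least `τ * l -
-- 1` counted fresh steps, hence a large weight.
open Classical in
theorem card_alive_le {l : ℕ} (hτ : 0 < τ) (hln : l < n) (C : CARule n → Prop)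
    (hC : ∀ f q v, q.2 ∉ B → C f → C (Function.update f q v)) :
    ((Finset.univ.filter fun f : CARule n => C f ∧ Alive B w y τ f (2 * τ * (τ * l))).card : ℝ) ≤
      (((n - l) / n : ℝ)) ^ (τ * l - 1) * (Finset.univ.filter C).card := by
  have hpos : (0 : ℝ) < n - l := by
    have : (l : ℝ) < n := by exact_mod_cast hln
    linarith
  have hl0 : (0 : ℝ) ≤ l := by positivity
  have hn : (0 : ℝ) < n := by linarith
  set c : ℝ := n / (n - l) with hc
  have hc0 : 0 < c := by positivity
  have hc1 : 1 ≤ c := by rw [hc, le_div_iff₀ hpos]; linarith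
  have hsum : ∀ t, ∑ f, aliveWeight B w y τ (τ * l) c C f t ≤ (Finset.univ.filter C).card := by
    intro t
    induction t with
    | zero =>
      rw [Finset.card_filter, Nat.cast_sum]
      refine Finset.sum_le_sum fun f _ => ?_
      unfold aliveWeight
      have : freshCount w y (τ * l) f 0 = 0 := by simp [freshCount]
      rw [this]
      split_ifs with h1 h2 h2
      · simp
      · exact absurd h1.1 h2
      · simp
      · simp
    | succ t ih => exact (sum_aliveWeight_succ_le hτ hln C hC t).trans ih
  have hlow : c ^ (τ * l - 1) * ((Finset.univ.filter fun f : CARule n =>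
      C f ∧ Alive B w y τ f (2 * τ * (τ * l))).card : ℝ) ≤
      ∑ f, aliveWeight B w y τ (τ * l) c C f (2 * τ * (τ * l)) := by
    rw [Finset.card_filter, Nat.cast_sum, Finset.mul_sum]
    refine Finset.sum_le_sum fun f _ => ?_
    unfold aliveWeight
    split_ifs with h1
    · rw [Nat.cast_one, mul_one]
      exact pow_le_pow_right₀ hc1 (le_freshCount hτ h1.2)
    · simp
  have hcinv : ((n - l) / n : ℝ) = c⁻¹ := by rw [hc, inv_div]
  rw [hcinv, inv_pow, inv_mul_eq_div, le_div_iff₀ (by positivity), mul_comm]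
  exact hlow.trans (hsum _)

open Classical in
/-- The probability that a walk along a periodic column is absorbed by `B`, given an event that does
not depend on the values of the rule outside `B`. -/
theorem card_absorbed_le {l : ℕ} (hτ : 0 < τ) (hln : l < n) (hw : ∀ t, w (t + τ) = w t)
    (hy : y ∉ B) (C : CARule n → Prop)
    (hC : ∀ f q v, q.2 ∉ B → C f → C (Function.update f q v)) :
    ((Finset.univ.filter fun f : CARule n => C f ∧ ∃ t, walk f w y t ∈ B).card : ℝ) ≤
      (2 * τ * (τ * l) * B.card / n + ((n - l) / n : ℝ) ^ (τ * l - 1)) *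
        (Finset.univ.filter C).card := by
  have hn : (0 : ℝ) < n := by
    have : 0 < n := by omega
    exact_mod_cast this
  set N := 2 * τ * (τ * l) with hN
  have hwmod : ∀ i j, i ≡ j [MOD τ] → w i = w j := by
    have h1 : Function.Periodic w τ := hw
    intro i j hij
    rw [← h1.map_mod_nat i, ← h1.map_mod_nat j, hij]
  have hsub : (Finset.univ.filter fun f : CARule n => C f ∧ ∃ t, walk f w y t ∈ B) ⊆
      ((Finset.range N).biUnion fun t => Finset.univ.filter fun f : CARule n =>
        C f ∧ (∀ s ≤ t, walk f w y s ∉ B) ∧ walk f w y (t + 1) ∈ B) ∪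
      Finset.univ.filter fun f : CARule n => C f ∧ Alive B w y τ f N := by
    intro f hf
    obtain ⟨hCf, hex⟩ := (Finset.mem_filter.1 hf).2
    have hspec := Nat.find_spec hex
    have hmin : ∀ s < Nat.find hex, walk f w y s ∉ B := fun s hs => Nat.find_min hex hs
    rcases Nat.eq_zero_or_eq_succ_pred (Nat.find hex) with h0 | h1
    · rw [h0] at hspec
      exact absurd hspec hy
    set j := (Nat.find hex).pred
    rw [h1] at hspec hmin
    rw [Finset.mem_union]
    rcases lt_or_ge j N with hj | hj
    · left
      refine Finset.mem_biUnion.2 ⟨j, Finset.mem_range.2 hj, ?_⟩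
      exact Finset.mem_filter.2 ⟨Finset.mem_univ _, hCf, fun s hs => hmin s (by omega), hspec⟩
    · right
      refine Finset.mem_filter.2 ⟨Finset.mem_univ _, hCf, fun s hs => hmin s (by omega), ?_⟩
      intro s hs s' hs' hmod heq
      -- After a repetition in the same phase the walk is periodic, so a later entrance into `B`
      -- would have an earlier copy.
      have hper : ∀ i, walk f w y (s' + i) = walk f w y (s + i) := by
        intro i
        rw [walk_add, walk_add, heq]
        congr 1
        funext r
        exact hwmod _ _ (hmod.add_right r)
      have h2 := hper (j + 1 - s)
      rw [show s + (j + 1 - s) = j + 1 by omega] at h2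
      exact hmin _ (by omega) (h2 ▸ hspec)
  have h1 := (Finset.card_le_card hsub).trans (Finset.card_union_le _ _)
  have h2 : (((Finset.range N).biUnion fun t => Finset.univ.filter fun f : CARule n =>
        C f ∧ (∀ s ≤ t, walk f w y s ∉ B) ∧ walk f w y (t + 1) ∈ B).card : ℝ) ≤
      N * (B.card * (Finset.univ.filter C).card / n) := by
    calc _ ≤ ((∑ t ∈ Finset.range N, (Finset.univ.filter fun f : CARule n =>
          C f ∧ (∀ s ≤ t, walk f w y s ∉ B) ∧ walk f w y (t + 1) ∈ B).card : ℕ) : ℝ) := by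
          exact_mod_cast Finset.card_biUnion_le
      _ ≤ ∑ t ∈ Finset.range N, (B.card * (Finset.univ.filter C).card / n : ℝ) := by
          rw [Nat.cast_sum]
          refine Finset.sum_le_sum fun t _ => ?_
          rw [le_div_iff₀ hn, mul_comm]
          exact card_enter_le C hC t
      _ = _ := by simp
  have h3 := card_alive_le (B := B) (w := w) (y := y) hτ hln C hC
  have h1' : ((Finset.univ.filter fun f : CARule n => C f ∧ ∃ t, walk f w y t ∈ B).card : ℝ) ≤ _ :=
    Nat.cast_le.2 h1
  rw [Nat.cast_add] at h1'
  refine h1'.trans ((add_le_add h2 h3).trans (le_of_eq ?_))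
  rw [hN]
  push_cast
  ring

end Absorption

/-! ### The probability that all walks join a given cycle -/

section Joining

variable {n : ℕ} {J : Type*}

/-- All walks along the columns `α` join the columns `ρ`; the set `J` indexes the phases of the
columns, which are run through by `nxt`. -/
def JoinsRoots (nxt : J → J) (α ρ : J → Fin n) (f : CARule n) : Prop :=
  ∀ j z, ∃ t, walk f (fun i => α (nxt^[i] j)) z t = ρ (nxt^[t] j)

/-- One simultaneous step of the phase and of the walk. -/
def phaseStep (nxt : J → J) (α : J → Fin n) (f : CARule n) (d : J × Fin n) : J × Fin n :=
  (nxt d.1, f (α d.1, d.2))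

theorem phaseStep_iterate (nxt : J → J) (α : J → Fin n) (f : CARule n) (j : J) (z : Fin n) (t : ℕ) :
    (phaseStep nxt α f)^[t] (j, z) = (nxt^[t] j, walk f (fun i => α (nxt^[i] j)) z t) := by
  induction t with
  | zero => rfl
  | succ t ih => rw [Function.iterate_succ_apply', ih, Function.iterate_succ_apply']; rfl

theorem joinsRoots_iff (nxt : J → J) (α ρ : J → Fin n) (f : CARule n) :
    JoinsRoots nxt α ρ f ↔
      ∀ d, ∃ t, ((phaseStep nxt α f)^[t] d).2 = ρ ((phaseStep nxt α f)^[t] d).1 := by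
  simp only [JoinsRoots, Prod.forall, phaseStep_iterate]

variable [DecidableEq J]

/-- The transition matrix between the nodes off the root, where `g` gives the new states. -/
def nodeMatrix (nxt : J → J) (ρ : J → Fin n) (g : {d : J × Fin n // d.2 ≠ ρ d.1} → Fin n) :
    Matrix {d : J × Fin n // d.2 ≠ ρ d.1} {d : J × Fin n // d.2 ≠ ρ d.1} ℝ :=
  fun d d' => if d'.1 = (nxt d.1.1, g d) then 1 else 0

/-- The transition matrix between phases. -/
def phaseMatrix (nxt : J → J) : Matrix J J ℝ := fun j k => if k = nxt j then 1 else 0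

/-- The argument of the rule that determines the successor of a node. -/
def nodeQuery (α ρ : J → Fin n) (d : {d : J × Fin n // d.2 ≠ ρ d.1}) : Fin n × Fin n :=
  (α d.1.1, d.1.2)

variable [Fintype J]

/-- Every transition lowers the time needed to reach a root, so ordering the nodes by this time
makes the matrix unitriangular. -/
theorem det_nodeMatrix_of_joinsRoots {nxt : J → J} {α ρ : J → Fin n} {f : CARule n}
    (h : JoinsRoots nxt α ρ f) :
    (1 - nodeMatrix nxt ρ (f ∘ nodeQuery α ρ)).det = 1 := by
  classical
  rw [joinsRoots_iff] at h
  set F := phaseStep nxt α f with hF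
  set M := nodeMatrix nxt ρ (f ∘ nodeQuery α ρ) with hM
  let hit : {d : J × Fin n // d.2 ≠ ρ d.1} → ℕ := fun d => Nat.find (h d.1)
  have hdec : ∀ d d', M d d' ≠ 0 → hit d' < hit d := by
    intro d d' hdd
    have heq : d'.1 = F d.1 := by
      by_contra hne
      exact hdd (if_neg hne)
    have hspec : (F^[hit d] d.1).2 = ρ (F^[hit d] d.1).1 := Nat.find_spec (h d.1)
    have h0 : hit d ≠ 0 := by
      intro h0
      rw [h0] at hspec
      exact d.2 hspec
    obtain ⟨m, hm⟩ := Nat.exists_eq_succ_of_ne_zero h0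
    have : hit d' ≤ m := by
      refine Nat.find_min' (h d'.1) ?_
      rw [heq, ← Function.iterate_succ_apply, ← hm]
      exact hspec
    omega
  have hdiag : ∀ d d', hit d = hit d' → M d d' = 0 := by
    intro d d' hdd
    by_contra hne
    exact absurd (hdec d d' hne) (by omega)
  have htri : (1 - M).BlockTriangular (fun d => OrderDual.toDual (hit d)) := by
    intro d d' hlt
    have hlt' : hit d < hit d' := hlt
    have h1 : M d d' = 0 := by
      by_contra hne
      exact absurd (hdec d d' hne) (by omega)
    have h2 : d ≠ d' := by rintro rfl; exact lt_irrefl _ hlt'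
    simp [h1, h2]
  rw [htri.det]
  refine Finset.prod_eq_one fun k _ => ?_
  have : (1 - M).toSquareBlock (fun d => OrderDual.toDual (hit d)) k = 1 := by
    ext d d'
    have : hit d.1 = hit d'.1 := OrderDual.toDual.injective (d.2.trans d'.2.symm)
    simp [Matrix.toSquareBlock, Matrix.toSquareBlockProp, hdiag _ _ this, Matrix.one_apply,
      Subtype.ext_iff]
  rw [this, Matrix.det_one]

/-- The indicator of the nodes that never reach a root is a nonzero vector fixed by the transition
matrix. -/
theorem det_nodeMatrix_of_not_joinsRoots {nxt : J → J} {α ρ : J → Fin n} {f : CARule n}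
    (h : ¬ JoinsRoots nxt α ρ f) :
    (1 - nodeMatrix nxt ρ (f ∘ nodeQuery α ρ)).det = 0 := by
  classical
  rw [joinsRoots_iff] at h
  push Not at h
  obtain ⟨d₀, hd₀⟩ := h
  set F := phaseStep nxt α f with hF
  let N : J × Fin n → Prop := fun d => ∀ t, (F^[t] d).2 ≠ ρ (F^[t] d).1
  have hroot : ∀ d, N d → d.2 ≠ ρ d.1 := fun d hd => hd 0
  have hstep : ∀ d : {d : J × Fin n // d.2 ≠ ρ d.1}, N (F d.1) ↔ N d.1 := by
    intro d
    constructor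
    · intro hN t
      cases t with
      | zero => exact d.2
      | succ t => exact hN t
    · intro hN t
      exact hN (t + 1)
  rw [← Matrix.exists_mulVec_eq_zero_iff]
  refine ⟨fun d => if N d.1 then 1 else 0, ?_, ?_⟩
  · intro h0
    have := congrFun h0 ⟨d₀, hroot d₀ hd₀⟩
    simp only [Pi.zero_apply] at this
    rw [if_pos hd₀] at this
    exact one_ne_zero this
  · rw [Matrix.sub_mulVec, Matrix.one_mulVec]
    funext d
    simp only [Pi.sub_apply, Pi.zero_apply, Matrix.mulVec, dotProduct, nodeMatrix]
    have hFd : (nxt d.1.1, (f ∘ nodeQuery α ρ) d) = F d.1 := rfl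
    rw [hFd]
    simp only [ite_mul, one_mul, zero_mul]
    by_cases hr : (F d.1).2 ≠ ρ (F d.1).1
    · rw [Finset.sum_eq_single ⟨F d.1, hr⟩]
      · simp [hstep d]
      · intro d' _ hne
        rw [if_neg]
        intro h1
        exact hne (Subtype.ext h1)
      · simp
    · rw [Finset.sum_eq_zero]
      · have : ¬ N d.1 := fun hN => hr (hroot _ ((hstep d).2 hN))
        simp [this]
      · intro d' _
        rw [if_neg]
        intro h1
        exact hr (h1 ▸ d'.2)

theorem card_node_phase (ρ : J → Fin n) (j : J) :
    (Finset.univ.filter fun d : {d : J × Fin n // d.2 ≠ ρ d.1} => d.1.1 = j).card = n - 1 := by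
  have : (Finset.univ.filter fun d : {d : J × Fin n // d.2 ≠ ρ d.1} => d.1.1 = j).card =
      (Finset.univ.erase (ρ j)).card := by
    refine Finset.card_bij' (fun d _ => d.1.2) (fun z hz => ⟨(j, z), Finset.ne_of_mem_erase hz⟩)
      ?_ ?_ ?_ ?_
    · rintro ⟨⟨k, z⟩, hz⟩ hk
      simp only [Finset.mem_filter, Finset.mem_univ, true_and] at hk
      subst hk
      simpa using hz
    · intro z hz
      simp
    · rintro ⟨⟨k, z⟩, hz⟩ hk
      simp only [Finset.mem_filter, Finset.mem_univ, true_and] at hk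
      subst hk
      rfl
    · intro z hz
      rfl
  rw [this, Finset.card_erase_of_mem (Finset.mem_univ _), Finset.card_univ, Fintype.card_fin]

/-- The average of the determinants over all possible transitions. -/
theorem sum_det_nodeMatrix (hn : 0 < n) (nxt : J → J) (ρ : J → Fin n) :
    ∑ g, (1 - nodeMatrix nxt ρ g).det =
      (n : ℝ) ^ Fintype.card {d : J × Fin n // d.2 ≠ ρ d.1} *
        (1 - ((n - 1) / n : ℝ) • phaseMatrix nxt).det := by
  have hn' : (n : ℝ) ≠ 0 := by positivity
  let row : {d : J × Fin n // d.2 ≠ ρ d.1} → Fin n → {d : J × Fin n // d.2 ≠ ρ d.1} → ℝ :=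
    fun d v d' => (1 : Matrix _ _ ℝ) d d' - if d'.1 = (nxt d.1.1, v) then 1 else 0
  -- Row `d` depends on `g` only through `g d`, so multilinearity moves the sum over `g` into the
  -- rows.
  have h1 : ∑ g, (1 - nodeMatrix nxt ρ g).det =
      Matrix.det (Matrix.of fun d => ∑ v, row d v) :=
    (Matrix.detRowAlternating.toMultilinearMap.map_sum row).symm
  -- The averaged transition depends only on phases, so it factors through `J`. Exchanging the
  -- factors in `det (1 - U * V)` leaves a matrix indexed by phases; each phase has `n - 1` nodes
  -- off the root, each of weight `1 / n`.
  let U : Matrix {d : J × Fin n // d.2 ≠ ρ d.1} J ℝ :=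
    fun d j => if j = nxt d.1.1 then (n : ℝ)⁻¹ else 0
  let V : Matrix J {d : J × Fin n // d.2 ≠ ρ d.1} ℝ := fun j d => if d.1.1 = j then 1 else 0
  have h2 : (Matrix.of fun d => ∑ v, row d v) = (n : ℝ) • (1 - U * V) := by
    ext d d'
    have hUV : (U * V) d d' = if d'.1.1 = nxt d.1.1 then (n : ℝ)⁻¹ else 0 := by
      rw [Matrix.mul_apply]
      simp [U, V]
    have hs : ∑ v, (if d'.1 = (nxt d.1.1, v) then (1 : ℝ) else 0) =
        if d'.1.1 = nxt d.1.1 then 1 else 0 := by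
      simp only [Prod.ext_iff, ite_and]
      split_ifs <;> simp
    simp only [Matrix.of_apply, Finset.sum_apply, row, Finset.sum_sub_distrib, hs,
      Finset.sum_const, Finset.card_univ, Fintype.card_fin, nsmul_eq_mul, Matrix.smul_apply,
      Matrix.sub_apply, hUV, smul_eq_mul]
    split_ifs
    · field_simp
    · ring
  have h3 : V * U = ((n - 1) / n : ℝ) • phaseMatrix nxt := by
    ext j k
    have hsum : (V * U) j k =
        ∑ d ∈ Finset.univ.filter fun d : {d : J × Fin n // d.2 ≠ ρ d.1} => d.1.1 = j, U d k := by
      rw [Matrix.mul_apply, Finset.sum_filter]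
      simp only [V, ite_mul, zero_mul, one_mul]
    have hU : ∀ d ∈ Finset.univ.filter fun d : {d : J × Fin n // d.2 ≠ ρ d.1} => d.1.1 = j,
        U d k = if k = nxt j then (n : ℝ)⁻¹ else 0 := by
      intro d hd
      simp only [U, (Finset.mem_filter.1 hd).2]
    rw [hsum, Finset.sum_congr rfl hU, Finset.sum_const, card_node_phase, nsmul_eq_mul,
      Nat.cast_pred hn, Matrix.smul_apply, phaseMatrix]
    split_ifs
    · rw [smul_eq_mul, mul_one, div_eq_mul_inv]
    · simp
  rw [h1, h2, Matrix.det_smul, Matrix.det_one_sub_mul_comm, h3]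

open Classical in
/-- The probability that all walks join the roots, given an event that does not depend on the
values of the rule at the nodes off the roots. -/
theorem card_joinsRoots (hn : 0 < n) (nxt : J → J) {α ρ : J → Fin n} (hα : Function.Injective α)
    (C : CARule n → Prop)
    (hC : ∀ f g, C f → C (Function.extend (nodeQuery α ρ) g f)) :
    ((Finset.univ.filter fun f => C f ∧ JoinsRoots nxt α ρ f).card : ℝ) =
      (Finset.univ.filter C).card * (1 - ((n - 1) / n : ℝ) • phaseMatrix nxt).det := by
  -- As `α` is injective, distinct nodes read distinct arguments, so their successors are
  -- independent.
  have hι : Function.Injective (nodeQuery α ρ) := by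
    rintro ⟨⟨j, z⟩, h⟩ ⟨⟨j', z'⟩, h'⟩ heq
    simp only [nodeQuery, Prod.mk.injEq] at heq
    obtain ⟨h1, rfl⟩ := heq
    obtain rfl := hα h1
    rfl
  have hn' : (n : ℝ) ≠ 0 := by positivity
  have h := sum_comp_mul_card_pow (R := Fin n) (nodeQuery α ρ) hι C hC
    (fun g => (1 - nodeMatrix nxt ρ g).det)
  rw [sum_det_nodeMatrix hn, Fintype.card_fin] at h
  have h1 : ∑ f with C f, (1 - nodeMatrix nxt ρ (f ∘ nodeQuery α ρ)).det =
      ((Finset.univ.filter fun f => C f ∧ JoinsRoots nxt α ρ f).card : ℝ) := by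
    rw [← Finset.filter_filter, Finset.card_filter, Nat.cast_sum]
    refine Finset.sum_congr rfl fun f _ => ?_
    split_ifs with hf
    · rw [det_nodeMatrix_of_joinsRoots hf, Nat.cast_one]
    · rw [det_nodeMatrix_of_not_joinsRoots hf, Nat.cast_zero]
  rw [h1] at h
  refine mul_right_cancel₀ (pow_ne_zero
    (Fintype.card {d : J × Fin n // d.2 ≠ ρ d.1}) hn') (h.trans ?_)
  ring

end Joining

/-! ### Determinants of phase matrices. -/

section PhaseMatrix

theorem det_one_sub_smul_phaseMatrix_fin (m : ℕ) (c : ℝ) :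
    (1 - c • phaseMatrix (fun j : Fin (m + 1) => j + 1)).det = 1 - c ^ (m + 1) := by
  -- Multiplication by this unitriangular matrix of powers of `c` clears all rows but the last,
  -- where the wrap-around leaves `1 - c ^ (m + 1)` on the diagonal.
  let U : Matrix (Fin (m + 1)) (Fin (m + 1)) ℝ :=
    fun i k => if i ≤ k then c ^ (k.val - i.val) else 0
  have hU : U.det = 1 := by
    rw [Matrix.det_of_isUpperTriangular]
    · simp [U]
    · intro i k hik
      exact if_neg (not_le.2 hik)
  have hmul : ∀ i k, ((1 - c • phaseMatrix (fun j : Fin (m + 1) => j + 1)) * U) i k =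
      U i k - c * U (i + 1) k := by
    intro i k
    rw [sub_mul, one_mul, smul_mul_assoc]
    simp [Matrix.mul_apply, phaseMatrix]
  have hne : ∀ i k, i ≠ Fin.last m →
      ((1 - c • phaseMatrix (fun j : Fin (m + 1) => j + 1)) * U) i k = if i = k then 1 else 0 := by
    intro i k hi
    have hv : (i + 1).val = i.val + 1 := Fin.val_add_one_of_lt (Fin.lt_last_iff_ne_last.2 hi)
    rw [hmul]
    simp only [U, Fin.le_def, hv, Fin.ext_iff]
    rcases lt_trichotomy i.val k.val with h | h | h
    · rw [if_pos h.le, if_pos (by omega), if_neg h.ne,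
        show k.val - i.val = (k.val - (i.val + 1)) + 1 by omega, pow_succ]
      ring
    · rw [if_pos h.le, if_neg (by omega), if_pos h, h]
      simp
    · rw [if_neg (by omega), if_neg (by omega), if_neg (by omega)]
      simp
  have hlast : ((1 - c • phaseMatrix (fun j : Fin (m + 1) => j + 1)) * U)
      (Fin.last m) (Fin.last m) = 1 - c ^ (m + 1) := by
    rw [hmul]
    simp [U, pow_succ, mul_comm]
  have hdet := Matrix.det_mul (1 - c • phaseMatrix (fun j : Fin (m + 1) => j + 1)) U
  rw [hU, mul_one] at hdet
  rw [← hdet, Matrix.det_of_isLowerTriangular, Fin.prod_univ_castSucc, hlast]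
  · rw [Finset.prod_eq_one, one_mul]
    intro i _
    rw [hne _ _ (Fin.castSucc_lt_last i).ne, if_pos rfl]
  · intro i k hik
    have hik' : i < k := hik
    have hi : i ≠ Fin.last m := by
      rintro rfl
      exact absurd hik' (not_lt.2 (Fin.le_last k))
    rw [hne _ _ hi, if_neg hik'.ne]

theorem det_one_sub_smul_phaseMatrix_zmod (τ : ℕ) [NeZero τ] (c : ℝ) :
    (1 - c • phaseMatrix (fun j : ZMod τ => j + 1)).det = 1 - c ^ τ := by
  cases τ with
  | zero => exact absurd rfl (NeZero.ne 0)
  | succ m => exact det_one_sub_smul_phaseMatrix_fin m c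

theorem det_one_sub_smul_phaseMatrix_sum {J K : Type*} [Fintype J] [Fintype K] [DecidableEq J]
    [DecidableEq K] (f : J → J) (g : K → K) (c : ℝ) :
    (1 - c • phaseMatrix (Sum.map f g)).det =
      (1 - c • phaseMatrix f).det * (1 - c • phaseMatrix g).det := by
  have : (1 - c • phaseMatrix (Sum.map f g)) =
      Matrix.fromBlocks (1 - c • phaseMatrix f) 0 0 (1 - c • phaseMatrix g) := by
    ext (i | i) (k | k) <;> simp [phaseMatrix, Matrix.one_apply]
  rw [this, Matrix.det_fromBlocks_zero₂₁]

end PhaseMatrix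

/-! ### Counting models of finite patterns -/

section Pattern

variable {n : ℕ} {I : Type*}

/-- A labelling `η` of a finite set of space-time sites is compatible with the rule `f`; the right
neighbor of a site `i` is `R i`, and its successor in time is `N i`. -/
def IsModel (R N : I → I) (f : CARule n) (η : I → Fin n) : Prop :=
  ∀ i, f (η i, η (R i)) = η (R (N i))

variable [Fintype I]

/-- The states used by a labelling. -/
def stateSet (η : I → Fin n) : Finset (Fin n) := Finset.univ.image η

/-- The pairs of adjacent states in a labelling. -/
def pairSet (R : I → I) (η : I → Fin n) : Finset (Fin n × Fin n) :=
  Finset.univ.image fun i => (η i, η (R i))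

theorem image_fst_pairSet (R : I → I) (η : I → Fin n) :
    (pairSet R η).image Prod.fst = stateSet η := by
  rw [pairSet, Finset.image_image]
  rfl

theorem image_snd_pairSet {R : I → I} (hR : Function.Surjective R) (η : I → Fin n) :
    (pairSet R η).image Prod.snd = stateSet η := by
  ext v
  simp only [pairSet, stateSet, Finset.mem_image, Finset.mem_univ, true_and, exists_exists_eq_and]
  exact ⟨fun ⟨i, hi⟩ => ⟨R i, hi⟩, fun ⟨i, hi⟩ => (hR i).elim fun j hj => ⟨j, hj ▸ hi⟩⟩

theorem card_stateSet_le_card_pairSet (R : I → I) (η : I → Fin n) :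
    (stateSet η).card ≤ (pairSet R η).card := by
  rw [← image_fst_pairSet R η]
  exact Finset.card_image_le

theorem mem_pairSet (R : I → I) (η : I → Fin n) (i : I) : (η i, η (R i)) ∈ pairSet R η :=
  Finset.mem_image_of_mem _ (Finset.mem_univ i)

/-- The projection of pairs to first coordinates is onto the states, hence injective when there are
no more pairs than states: a state determines its right neighbor. -/
theorem right_eq_of_card_pairSet_le {R : I → I} {η : I → Fin n}
    (h : (pairSet R η).card ≤ (stateSet η).card) {i j : I} (hij : η i = η j) :
    η (R i) = η (R j) := by
  rw [← image_fst_pairSet R η] at h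
  have hinj := Finset.injOn_of_card_image_eq (le_antisymm Finset.card_image_le h)
  exact congrArg Prod.snd (hinj (mem_pairSet R η i) (mem_pairSet R η j) hij)

theorem eq_of_right_eq_of_card_pairSet_le {R : I → I} (hR : Function.Surjective R) {η : I → Fin n}
    (h : (pairSet R η).card ≤ (stateSet η).card) {i j : I} (hij : η (R i) = η (R j)) :
    η i = η j := by
  rw [← image_snd_pairSet hR η] at h
  have hinj := Finset.injOn_of_card_image_eq (le_antisymm Finset.card_image_le h)
  exact congrArg Prod.fst (hinj (mem_pairSet R η i) (mem_pairSet R η j) hij)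

/-- The states at `i` and at its right neighbor fix the next state of that neighbor; since right
neighbors also determine left ones, the next state at `i` follows. -/
theorem IsModel.next_eq {R N : I → I} {f : CARule n} {η : I → Fin n} (hf : IsModel R N f η)
    (hR : Function.Surjective R) (h : (pairSet R η).card ≤ (stateSet η).card) {i j : I}
    (hij : η i = η j) : η (N i) = η (N j) := by
  refine eq_of_right_eq_of_card_pairSet_le hR h ?_
  rw [← hf i, ← hf j, hij, right_eq_of_card_pairSet_le h hij]

open Classical in
theorem card_isModel_le (hn : 0 < n) (R N : I → I) (η : I → Fin n) :
    ((Finset.univ.filter fun f : CARule n => IsModel R N f η).card : ℝ) ≤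
      (n : ℝ) ^ (n * n) * ((n : ℝ)⁻¹) ^ (pairSet R η).card := by
  have h : ((Finset.univ.filter fun f : CARule n => IsModel R N f η).card : ℝ) *
      (Fintype.card (Fin n) : ℝ) ^ (pairSet R η).card ≤
        (Fintype.card (Fin n) : ℝ) ^ Fintype.card (Fin n × Fin n) := by
    convert card_filter_forall_le (R := Fin n) (fun i => (η i, η (R i))) (fun i => η (R (N i)))
    · exact Iff.rfl
    · rfl
  rw [Fintype.card_fin, Fintype.card_prod, Fintype.card_fin] at h
  have hn' : (0 : ℝ) < n := by exact_mod_cast hn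
  rw [inv_pow, ← div_eq_mul_inv, le_div_iff₀ (by positivity)]
  exact h

/-- The labellings with few states are few. -/
theorem sum_inv_pow_card_stateSet_le [DecidableEq I] (hn : 0 < n) :
    ∑ η : I → Fin n, ((n : ℝ)⁻¹) ^ (stateSet η).card ≤
      (Fintype.card I : ℝ) ^ Fintype.card I := by
  classical
  have hn' : (0 : ℝ) < n := by exact_mod_cast hn
  have hex : ∀ (η : I → Fin n) (v : {v // v ∈ stateSet η}), ∃ i, η i = v.1 := by
    intro η v
    obtain ⟨i, -, hi⟩ := Finset.mem_image.1 v.2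
    exact ⟨i, hi⟩
  choose rep hrep using hex
  -- Each site is sent to a chosen representative with the same state. For a given such map at most
  -- `n ^ (number of states)` labellings are possible, which cancels the weight.
  let π : (I → Fin n) → I → I := fun η i =>
    rep η ⟨η i, Finset.mem_image_of_mem η (Finset.mem_univ i)⟩
  have hπ : ∀ (η : I → Fin n) i, η (π η i) = η i := fun η i => hrep η _
  have hcard : ∀ η, (Finset.univ.image (π η)).card = (stateSet η).card := by
    intro η
    have : (Finset.univ.image (π η)).image η = stateSet η := by
      rw [Finset.image_image]
      exact Finset.image_congr fun i _ => hπ η i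
    rw [← this, eq_comm, Finset.card_image_of_injOn]
    intro a ha b hb hab
    simp only [Finset.coe_image, Finset.coe_univ, Set.image_univ, Set.mem_range] at ha hb
    obtain ⟨i, rfl⟩ := ha
    obtain ⟨j, rfl⟩ := hb
    replace hab : η i = η j := (hπ η i).symm.trans (hab.trans (hπ η j))
    simp only [π, hab]
  have hfib : ∀ p : I → I, ∑ η with π η = p, ((n : ℝ)⁻¹) ^ (stateSet η).card ≤ 1 := by
    intro p
    have h1 : ∀ η ∈ Finset.univ.filter fun η => π η = p,
        ((n : ℝ)⁻¹) ^ (stateSet η).card = ((n : ℝ)⁻¹) ^ (Finset.univ.image p).card := by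
      intro η hη
      rw [← hcard, (Finset.mem_filter.1 hη).2]
    rw [Finset.sum_congr rfl h1, Finset.sum_const, nsmul_eq_mul]
    have h2 : (Finset.univ.filter fun η : I → Fin n => π η = p).card ≤
        n ^ (Finset.univ.image p).card := by
      have hmap : Set.InjOn (fun (η : I → Fin n) (i : {i // i ∈ Finset.univ.image p}) => η i.1)
          (Finset.univ.filter fun η : I → Fin n => π η = p) := by
        intro η hη η' hη' heq
        simp only [Finset.coe_filter, Finset.mem_univ, true_and, Set.mem_ofPred_eq] at hη hη'
        funext i
        rw [← hπ η i, ← hπ η' i, hη, hη']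
        exact congrFun heq ⟨p i, Finset.mem_image_of_mem p (Finset.mem_univ i)⟩
      have := Finset.card_le_card_of_injOn
        (t := (Finset.univ : Finset ({i // i ∈ Finset.univ.image p} → Fin n))) _
        (fun _ _ => Finset.mem_coe.2 (Finset.mem_univ _)) hmap
      rwa [Finset.card_univ, Fintype.card_fun, Fintype.card_coe, Fintype.card_fin] at this
    rw [inv_pow, ← div_eq_mul_inv, div_le_one (by positivity)]
    exact_mod_cast h2
  calc ∑ η : I → Fin n, ((n : ℝ)⁻¹) ^ (stateSet η).card
      = ∑ p : I → I, ∑ η with π η = p, ((n : ℝ)⁻¹) ^ (stateSet η).card :=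
        (Finset.sum_fiberwise _ _ _).symm
    _ ≤ ∑ _p : I → I, (1 : ℝ) := Finset.sum_le_sum fun p _ => hfib p
    _ = _ := by simp

/-! ### Asymptotics of the absorption bound. -/

/-- The number of steps per phase that is used in the absorption estimate. -/
def absorbScale (n : ℕ) : ℕ := n.sqrt * n.sqrt.sqrt

/-- An upper bound for the absorption probability. -/
noncomputable def absorbBound (τ K n : ℕ) : ℝ :=
  2 * τ * (τ * absorbScale n) * K / n + ((n - absorbScale n) / n : ℝ) ^ (τ * absorbScale n - 1)

theorem absorbScale_lt {n : ℕ} (hn : 4 ≤ n) : absorbScale n < n := by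
  have h1 : 2 ≤ n.sqrt := Nat.le_sqrt.2 (by omega)
  have h2 : n.sqrt.sqrt < n.sqrt := Nat.sqrt_lt_self (by omega)
  calc n.sqrt * n.sqrt.sqrt < n.sqrt * n.sqrt := Nat.mul_lt_mul_of_pos_left h2 (by omega)
    _ ≤ n := Nat.sqrt_le n

theorem tendsto_sqrt_atTop : Tendsto Nat.sqrt atTop atTop :=
  tendsto_atTop.2 fun b => (eventually_ge_atTop (b * b)).mono fun _ h => Nat.le_sqrt.2 h

/-- The scale `l ≈ n^(3/4)` lies between `√n` and `n`: the entrance term is of order `l / n`, and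
the survival term is about `exp (-τ l² / n)`. -/
theorem tendsto_absorbBound (τ K : ℕ) (hτ : 0 < τ) :
    Tendsto (absorbBound τ K) atTop (nhds 0) := by
  have hr : Tendsto (fun n : ℕ => ((n.sqrt.sqrt : ℕ) : ℝ)) atTop atTop :=
    tendsto_natCast_atTop_atTop.comp (tendsto_sqrt_atTop.comp tendsto_sqrt_atTop)
  have hlim : Tendsto (fun n : ℕ => 2 * τ * τ * K / ((n.sqrt.sqrt : ℕ) : ℝ) +
      Real.exp (1 - ((n.sqrt.sqrt : ℕ) : ℝ) / 4)) atTop (nhds 0) := by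
    have h1 : Tendsto (fun n : ℕ => (2 * τ * τ * K : ℝ) / ((n.sqrt.sqrt : ℕ) : ℝ)) atTop (nhds 0) :=
      hr.const_div_atTop _
    have h2 : Tendsto (fun n : ℕ => Real.exp (1 - ((n.sqrt.sqrt : ℕ) : ℝ) / 4)) atTop (nhds 0) := by
      refine Real.tendsto_exp_atBot.comp ?_
      have := tendsto_neg_atTop_atBot.comp (hr.atTop_div_const (by norm_num : (0 : ℝ) < 4))
      exact tendsto_atBot_add_const_left _ 1 this
    simpa using h1.add h2
  refine squeeze_zero' ?_ ?_ hlim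
  · filter_upwards [eventually_ge_atTop 4] with n hn
    have : (absorbScale n : ℝ) ≤ n := by exact_mod_cast (absorbScale_lt hn).le
    have h0 : (0 : ℝ) ≤ (n - absorbScale n) / n := div_nonneg (by linarith) (by positivity)
    unfold absorbBound
    positivity
  · filter_upwards [eventually_ge_atTop 4] with n hn
    have hlt := absorbScale_lt hn
    set s := n.sqrt with hs
    set r := s.sqrt with hrr
    have hs2 : 2 ≤ s := Nat.le_sqrt.2 (by omega)
    have hr1 : 1 ≤ r := Nat.le_sqrt.2 (by omega)
    have hss : s * s ≤ n := Nat.sqrt_le n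
    have hrs : r * r ≤ s := Nat.sqrt_le s
    have hns : n < (s + 1) * (s + 1) := Nat.lt_succ_sqrt n
    have hl : (absorbScale n : ℝ) = s * r := by
      rw [← Nat.cast_mul]
      rfl
    have hτ' : (1 : ℝ) ≤ τ := by exact_mod_cast hτ
    have hr1' : (1 : ℝ) ≤ r := by exact_mod_cast hr1
    have hrs' : (r : ℝ) * r ≤ s := by exact_mod_cast hrs
    have hss' : (s : ℝ) * s ≤ n := by exact_mod_cast hss
    have hs2' : (2 : ℝ) ≤ s := by exact_mod_cast hs2
    have hns' : (n : ℝ) ≤ 4 * (s * s) := by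
      have : (n : ℝ) < (s + 1) * (s + 1) := by exact_mod_cast hns
      nlinarith
    have hlt' : (s * r : ℝ) < n := by
      rw [← hl]
      exact_mod_cast hlt
    have hn' : (0 : ℝ) < n := by nlinarith
    have hl1 : 1 ≤ absorbScale n := Nat.mul_pos (show 0 < s by omega) hr1
    refine add_le_add ?_ ?_
    · rw [hl, div_le_div_iff₀ hn' (by linarith)]
      have : (s * r * r : ℝ) ≤ n := by nlinarith
      calc 2 * τ * (τ * (s * r)) * K * (r : ℝ) = 2 * τ * τ * K * (s * r * r) := by ring
        _ ≤ _ := by gcongr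
    · have h1 : ((n - absorbScale n) / n : ℝ) ≤ Real.exp (-(s * r / n)) := by
        rw [hl, ← one_sub_div hn'.ne']
        exact Real.one_sub_le_exp_neg _
      have h0 : (0 : ℝ) ≤ (n - absorbScale n) / n :=
        div_nonneg (by rw [hl]; linarith) hn'.le
      refine (pow_le_pow_left₀ h0 h1 _).trans ?_
      rw [← Real.exp_nat_mul, Real.exp_le_exp, Nat.cast_sub (Nat.mul_pos hτ hl1), Nat.cast_mul, hl,
        Nat.cast_one]
      have h2 : (s * r : ℝ) / n ≤ 1 := (div_le_one hn').2 hlt'.le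
      have h3 : (r : ℝ) / 4 ≤ τ * (s * r) * (s * r / n) := by
        rw [← mul_div_assoc, div_le_div_iff₀ (by norm_num) hn']
        calc (r : ℝ) * n ≤ r * (4 * (s * s)) := by gcongr
          _ = 1 * (s * (s * r)) * 1 * 4 := by ring
          _ ≤ τ * (s * (s * r)) * r * 4 := by gcongr
          _ = _ := by ring
      nlinarith

/-! ### Joining probabilities for patterns. -/

variable {J : Type*}

-- Joining forces a walk started at a state outside the pattern to enter `stateSet η`. Compatibility
-- involves only arguments whose second entry lies in this set, so the absorption bound applies
-- conditionally.
open Classical in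
theorem card_isModel_joinsRoots_le (hn : 4 ≤ n) (hI : Fintype.card I < n) (R N : I → I)
    (η : I → Fin n) (nxt : J → J) (a : J → I) {τ : ℕ} (hτ : 0 < τ) (j : J)
    (hj : nxt^[τ] j = j) :
    ((Finset.univ.filter fun f : CARule n => IsModel R N f η ∧
      JoinsRoots nxt (fun j => η (a j)) (fun j => η (R (a j))) f).card : ℝ) ≤
      absorbBound τ (Fintype.card I) n *
        (Finset.univ.filter fun f : CARule n => IsModel R N f η).card := by
  have hBI : (stateSet η).card ≤ Fintype.card I := Finset.card_image_le
  obtain ⟨y, hy⟩ : ∃ y, y ∉ stateSet η := by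
    by_contra! hall
    have : stateSet η = Finset.univ := Finset.eq_univ_iff_forall.2 hall
    rw [this, Finset.card_univ, Fintype.card_fin] at hBI
    omega
  have hw : ∀ t, η (a (nxt^[t + τ] j)) = η (a (nxt^[t] j)) := by
    intro t
    rw [Function.iterate_add_apply, hj]
  have key := card_absorbed_le (w := fun i => η (a (nxt^[i] j))) hτ (absorbScale_lt hn) hw hy
    (fun f => IsModel R N f η) (by
      intro f q v hq hf i
      rw [Function.update_of_ne]
      · exact hf i
      · rintro rfl
        exact hq (Finset.mem_image_of_mem η (Finset.mem_univ _)))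
  calc _ ≤ ((Finset.univ.filter fun f : CARule n => IsModel R N f η ∧
        ∃ t, walk f (fun i => η (a (nxt^[i] j))) y t ∈ stateSet η).card : ℝ) := by
        refine Nat.cast_le.2 (Finset.card_le_card (Finset.monotone_filter_right _ ?_))
        intro f _ hf
        obtain ⟨t, ht⟩ := hf.2 j y
        exact ⟨hf.1, t, ht ▸ Finset.mem_image_of_mem η (Finset.mem_univ _)⟩
    _ ≤ _ := key
    _ ≤ _ := by
        unfold absorbBound
        gcongr

-- Right neighbors are determined by states here, so no argument read off the roots is a pair of the
-- pattern. Hence compatibility is independent of joining.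
open Classical in
theorem card_isModel_joinsRoots_eq [DecidableEq J] [Fintype J] (hn : 0 < n) (R N : I → I)
    (η : I → Fin n) (nxt : J → J) (a : J → I) (ha : Function.Injective fun j => η (a j))
    (h : (pairSet R η).card ≤ (stateSet η).card) :
    ((Finset.univ.filter fun f : CARule n => IsModel R N f η ∧
      JoinsRoots nxt (fun j => η (a j)) (fun j => η (R (a j))) f).card : ℝ) =
      (Finset.univ.filter fun f : CARule n => IsModel R N f η).card *
        (1 - ((n - 1) / n : ℝ) • phaseMatrix nxt).det := by
  refine card_joinsRoots hn nxt ha (fun f => IsModel R N f η) fun f g hf i => ?_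
  rw [Function.extend_apply']
  · exact hf i
  · rintro ⟨⟨⟨j, z⟩, hz⟩, heq⟩
    simp only [nodeQuery, Prod.mk.injEq] at heq
    exact hz (heq.2.trans (right_eq_of_card_pairSet_le h heq.1.symm))

theorem one_sub_pow_le (hn : 0 < n) (τ : ℕ) : 1 - ((n - 1) / n : ℝ) ^ τ ≤ τ / n := by
  have hn' : (1 : ℝ) ≤ n := by exact_mod_cast hn
  have h := one_add_mul_le_pow (a := -(1 / n : ℝ)) (by
    have : 1 / (n : ℝ) ≤ 1 := by rw [div_le_one (by linarith)]; exact hn'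
    linarith) τ
  have h2 : (1 + -(1 / n : ℝ)) = (n - 1) / n := by field_simp; ring
  rw [h2] at h
  have h3 : (τ : ℝ) * -(1 / n) = -(τ / n) := by ring
  rw [h3] at h
  linarith

/-- The phases of a pair of columns. -/
abbrev pairNext (τ τ' : ℕ) : ZMod τ ⊕ ZMod τ' → ZMod τ ⊕ ZMod τ' :=
  Sum.map (· + 1) (· + 1)

theorem add_one_iterate (τ t : ℕ) (j : ZMod τ) : (fun i : ZMod τ => i + 1)^[t] j = j + t := by
  induction t with
  | zero => simp
  | succ t ih => rw [Function.iterate_succ_apply', ih]; push_cast; ring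

theorem pairNext_iterate_inl (τ τ' t : ℕ) (j : ZMod τ) :
    (pairNext τ τ')^[t] (Sum.inl j) = Sum.inl (j + t) := by
  induction t with
  | zero => simp
  | succ t ih =>
    rw [Function.iterate_succ_apply', ih, pairNext, Sum.map_inl]
    push_cast
    rw [add_assoc]

theorem pairNext_iterate_inr (τ τ' t : ℕ) (j : ZMod τ') :
    (pairNext τ τ')^[t] (Sum.inr j) = Sum.inr (j + t) := by
  induction t with
  | zero => simp
  | succ t ih =>
    rw [Function.iterate_succ_apply', ih, pairNext, Sum.map_inr]
    push_cast
    rw [add_assoc]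

/-- Labellings compatible with `f` in which all walks along two columns join the columns to their
right, and which either have more pairs than states, or have two columns without repetitions. -/
def IsExceptional (R N : I → I) {τ τ' : ℕ} (a : ZMod τ ⊕ ZMod τ' → I) (f : CARule n)
    (η : I → Fin n) : Prop :=
  ((stateSet η).card < (pairSet R η).card ∨ Function.Injective fun j => η (a j)) ∧
    IsModel R N f η ∧ JoinsRoots (pairNext τ τ') (fun j => η (a j)) (fun j => η (R (a j))) f

open Classical in
/-- Exceptional labellings are negligible. -/
theorem tendsto_exceptional [DecidableEq I] (R N : I → I) (τ τ' : ℕ) [NeZero τ] [NeZero τ']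
    (a : ZMod τ ⊕ ZMod τ' → I) :
    Tendsto (fun n : ℕ => (n : ℝ) * ((∑ f : CARule n,
      ((Finset.univ.filter fun η : I → Fin n => IsExceptional R N a f η).card : ℝ)) /
        (n : ℝ) ^ (n * n))) atTop (nhds 0) := by
  set K : ℝ := (Fintype.card I : ℝ) ^ Fintype.card I
  have hτ : 0 < τ := Nat.pos_of_ne_zero (NeZero.ne τ)
  have hlim : Tendsto (fun n : ℕ => K * (absorbBound τ (Fintype.card I) n + (τ * τ' : ℝ) / n))
      atTop (nhds 0) := by
    simpa using ((tendsto_absorbBound τ (Fintype.card I) hτ).add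
      (tendsto_const_div_atTop_nhds_zero_nat (τ * τ' : ℝ))).const_mul K
  refine squeeze_zero' (Eventually.of_forall fun n => by positivity) ?_ hlim
  filter_upwards [eventually_ge_atTop 4, eventually_gt_atTop (Fintype.card I)] with n hn hI
  have hn0 : 0 < n := by omega
  have hn' : (0 : ℝ) < n := by exact_mod_cast hn0
  have hn1 : (1 : ℝ) ≤ n := by exact_mod_cast hn0
  set ε := absorbBound τ (Fintype.card I) n with hε
  have hε0 : 0 ≤ ε := by
    have : (absorbScale n : ℝ) ≤ n := by exact_mod_cast (absorbScale_lt hn).le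
    have h0 : (0 : ℝ) ≤ (n - absorbScale n) / n := div_nonneg (by linarith) (by positivity)
    rw [hε, absorbBound]
    positivity
  -- Compared with `n⁻¹` to the number of states, both kinds of exceptional labellings gain a factor
  -- `o(1) / n`.
  have hpt : ∀ η : I → Fin n,
      ((Finset.univ.filter fun f : CARule n => IsExceptional R N a f η).card : ℝ) ≤
        (n : ℝ) ^ (n * n) * (ε + (τ * τ' : ℝ) / n) / n * ((n : ℝ)⁻¹) ^ (stateSet η).card := by
    intro η
    have hmono : ((Finset.univ.filter fun f : CARule n => IsExceptional R N a f η).card : ℝ) ≤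
        ((Finset.univ.filter fun f : CARule n => IsModel R N f η ∧ JoinsRoots (pairNext τ τ')
          (fun j => η (a j)) (fun j => η (R (a j))) f).card : ℝ) :=
      Nat.cast_le.2 (Finset.card_le_card (Finset.monotone_filter_right _ fun f _ hf => hf.2))
    have hmod := card_isModel_le hn0 R N η
    rcases lt_or_ge (stateSet η).card (pairSet R η).card with hlt | hle
    · have h1 := card_isModel_joinsRoots_le hn hI R N η (pairNext τ τ') a hτ (Sum.inl 0)
        (by simp [pairNext_iterate_inl])
      have h2 : ((n : ℝ)⁻¹) ^ (pairSet R η).card ≤ ((n : ℝ)⁻¹) ^ ((stateSet η).card + 1) :=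
        pow_le_pow_of_le_one (by positivity) (inv_le_one_of_one_le₀ hn1) hlt
      calc _ ≤ ε * ((n : ℝ) ^ (n * n) * ((n : ℝ)⁻¹) ^ ((stateSet η).card + 1)) := by
            refine hmono.trans (h1.trans ?_)
            gcongr
            exact hmod.trans (by gcongr)
        _ = (n : ℝ) ^ (n * n) * ε / n * ((n : ℝ)⁻¹) ^ (stateSet η).card := by
            rw [pow_succ]; field_simp
        _ ≤ _ := by
            gcongr
            have : (0 : ℝ) ≤ (τ * τ' : ℝ) / n := by positivity
            linarith
    · by_cases hinj : Function.Injective fun j => η (a j)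
      · have h1 := card_isModel_joinsRoots_eq hn0 R N η (pairNext τ τ') a hinj hle
        rw [det_one_sub_smul_phaseMatrix_sum, det_one_sub_smul_phaseMatrix_zmod,
          det_one_sub_smul_phaseMatrix_zmod] at h1
        have hc0 : (0 : ℝ) ≤ (n - 1) / n := div_nonneg (by linarith) hn'.le
        have hc1 : ((n - 1) / n : ℝ) ≤ 1 := by rw [div_le_one hn']; linarith
        have hd : (1 - ((n - 1) / n : ℝ) ^ τ) * (1 - ((n - 1) / n : ℝ) ^ τ') ≤
            (τ / n) * (τ' / n) :=
          mul_le_mul (one_sub_pow_le hn0 τ) (one_sub_pow_le hn0 τ')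
            (sub_nonneg.2 (pow_le_one₀ hc0 hc1)) (by positivity)
        have h2 : ((n : ℝ)⁻¹) ^ (pairSet R η).card ≤ ((n : ℝ)⁻¹) ^ (stateSet η).card :=
          pow_le_pow_of_le_one (by positivity) (inv_le_one_of_one_le₀ hn1)
            (card_stateSet_le_card_pairSet R η)
        calc _ ≤ ((n : ℝ) ^ (n * n) * ((n : ℝ)⁻¹) ^ (stateSet η).card) *
              ((τ / n) * (τ' / n)) := by
              rw [h1] at hmono
              refine hmono.trans ((mul_le_mul_of_nonneg_left hd (by positivity)).trans ?_)
              gcongr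
              exact hmod.trans (by gcongr)
          _ = (n : ℝ) ^ (n * n) * ((τ * τ' : ℝ) / n) / n * ((n : ℝ)⁻¹) ^ (stateSet η).card := by
              field_simp
          _ ≤ _ := by
              gcongr
              linarith
      · have : (Finset.univ.filter fun f : CARule n => IsExceptional R N a f η) = ∅ := by
          rw [Finset.filter_eq_empty_iff]
          rintro f - ⟨h1 | h1, -⟩
          · omega
          · exact hinj h1
        rw [this, Finset.card_empty, Nat.cast_zero]
        positivity
  have hswap : (∑ f : CARule n,
      ((Finset.univ.filter fun η : I → Fin n => IsExceptional R N a f η).card : ℝ)) =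
      ∑ η : I → Fin n, ((Finset.univ.filter fun f : CARule n =>
        IsExceptional R N a f η).card : ℝ) := by
    simp only [Finset.card_filter, Nat.cast_sum]
    exact Finset.sum_comm
  rw [hswap]
  have hsum : ∑ η : I → Fin n, ((Finset.univ.filter fun f : CARule n =>
      IsExceptional R N a f η).card : ℝ) ≤
      (n : ℝ) ^ (n * n) * (ε + (τ * τ' : ℝ) / n) / n * K := by
    refine (Finset.sum_le_sum fun η _ => hpt η).trans ?_
    rw [← Finset.mul_sum]
    gcongr
    exact sum_inv_pow_card_stateSet_le hn0
  calc _ ≤ (n : ℝ) * (((n : ℝ) ^ (n * n) * (ε + (τ * τ' : ℝ) / n) / n * K) /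
        (n : ℝ) ^ (n * n)) := by gcongr
    _ = K * (ε + (τ * τ' : ℝ) / n) := by field_simp

end Pattern

/-! ### Cycles that generate weakly robust periodic solutions -/

section GoodCycle

variable {n τ : ℕ}

/-- The injective cycle of states `b` generates the weakly robust periodic solution
`ξ_t(x) = b (t + x * m)`. -/
def IsGoodCycle (m : ZMod τ) (f : CARule n) (b : ZMod τ → Fin n) : Prop :=
  Function.Injective b ∧ IsModel (· + m) (· + 1) f b ∧
    JoinsRoots (· + 1) b (fun j => b (j + m)) f

theorem IsGoodCycle.evolve {m : ZMod τ} {f : CARule n} {b : ZMod τ → Fin n}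
    (h : IsGoodCycle m f b) (t : ℕ) (x : ℤ) :
    f.evolve (fun x => b (x * m)) t x = b (t + x * m) := by
  induction t generalizing x with
  | zero => simp [CARule.evolve]
  | succ t ih =>
    rw [evolve_succ_apply, ih, ih]
    have := h.2.1 (t + (x - 1 : ℤ) * m)
    have h1 : (t : ZMod τ) + x * m = t + (x - 1 : ℤ) * m + m := by push_cast; ring
    have h2 : ((t + 1 : ℕ) : ZMod τ) + x * m = t + (x - 1 : ℤ) * m + 1 + m := by push_cast; ring
    rw [h1, h2]
    exact this

theorem IsGoodCycle.isPeriodicSolution [NeZero τ] {m : ZMod τ} {f : CARule n}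
    {b : ZMod τ → Fin n} (h : IsGoodCycle m f b) :
    IsPeriodicSolution f τ (addOrderOf m) (fun x => b (x * m)) := by
  refine ⟨⟨⟨addOrderOf_pos m, fun x => ?_⟩, fun s hs => ?_⟩, ⟨⟨?_, ?_⟩, fun t ht => ?_⟩⟩
  · have h0 : ((addOrderOf m : ℕ) : ZMod τ) * m = 0 := by
      rw [← nsmul_eq_mul]
      exact addOrderOf_nsmul_eq_zero m
    push_cast
    rw [add_mul, h0, add_zero]
  · have h0 := h.1 (hs.2 0)
    push_cast at h0
    rw [zero_mul, zero_add, ← nsmul_eq_mul] at h0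
    exact Nat.le_of_dvd hs.1 (addOrderOf_dvd_of_nsmul_eq_zero h0.symm)
  · exact Nat.pos_of_ne_zero (NeZero.ne τ)
  · funext x
    rw [h.evolve]
    simp
  · have h0 := congrFun ht.2 0
    rw [h.evolve] at h0
    have h1 := h.1 h0
    simp only [Int.cast_zero, zero_mul, add_zero] at h1
    exact Nat.le_of_dvd ht.1 ((ZMod.natCast_eq_zero_iff t τ).1 h1)

theorem IsGoodCycle.expansionVelocity_pos [NeZero τ] {m : ZMod τ} {f : CARule n}
    {b : ZMod τ → Fin n} (h : IsGoodCycle m f b) :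
    0 < expansionVelocity f (fun x => b (x * m)) := by
  choose T hT using h.2.2
  -- There are finitely many phases and starting states, so the joining times are bounded uniformly.
  set K := (Finset.univ : Finset (ZMod τ × Fin n)).sup fun p => T p.1 p.2
  refine expansionVelocity_pos_of_walk (K := K + 1) (Nat.succ_pos K) fun x s z => ?_
  set j : ZMod τ := s + x * m with hj
  refine ⟨T j z, ?_, ?_⟩
  · exact (Finset.le_sup (f := fun p : ZMod τ × Fin n => T p.1 p.2)
      (Finset.mem_univ (j, z))).trans (Nat.le_succ K)
  · have := hT j z
    simp only [add_one_iterate] at this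
    simp only [h.evolve]
    convert this using 2
    · funext i
      rw [hj]
      congr 1
      push_cast
      ring
    · rw [hj]
      push_cast
      ring

/-- A cycle can be rotated. -/
theorem IsGoodCycle.rotate {m : ZMod τ} {f : CARule n} {b : ZMod τ → Fin n}
    (h : IsGoodCycle m f b) (c : ZMod τ) : IsGoodCycle m f (fun i => b (i + c)) := by
  refine ⟨fun i j hij => add_right_cancel (h.1 hij), fun i => ?_, fun j z => ?_⟩
  · have := h.2.1 (i + c)
    simp only at this ⊢
    rw [add_right_comm i m c, show i + 1 + m + c = i + c + 1 + m by ring]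
    exact this
  · obtain ⟨t, ht⟩ := h.2.2 (j + c) z
    refine ⟨t, ?_⟩
    simp only [add_one_iterate] at ht ⊢
    convert ht using 2
    · funext i
      congr 1
      ring
    · ring

theorem joinsRoots_pairNext {τ' : ℕ} {α ρ : ZMod τ ⊕ ZMod τ' → Fin n} {f : CARule n}
    (hl : ∀ (j : ZMod τ) z, ∃ t : ℕ, walk f (fun i => α (Sum.inl (j + i))) z t =
      ρ (Sum.inl (j + t)))
    (hr : ∀ (j : ZMod τ') z, ∃ t : ℕ, walk f (fun i => α (Sum.inr (j + i))) z t =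
      ρ (Sum.inr (j + t))) :
    JoinsRoots (pairNext τ τ') α ρ f := by
  rintro (j | j) z
  · simpa only [pairNext_iterate_inl] using hl j z
  · simpa only [pairNext_iterate_inr] using hr j z

/-- Two cycles for the same rule have a common rotation, unless they form an exceptional
labelling. -/
theorem IsGoodCycle.exists_common_rotation [NeZero τ] {τ' : ℕ} [NeZero τ'] {m : ZMod τ}
    {m' : ZMod τ'} {f : CARule n} {b : ZMod τ → Fin n} {b' : ZMod τ' → Fin n}
    (h : IsGoodCycle m f b) (h' : IsGoodCycle m' f b')
    (hex : ¬ IsExceptional (Sum.map (· + m) (· + m')) (pairNext τ τ') id f (Sum.elim b b')) :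
    ∃ u u', (∀ k : ℕ, b (u + k) = b' (u' + k)) ∧ b (u + m) = b' (u' + m') := by
  have hmod : IsModel (Sum.map (· + m) (· + m')) (pairNext τ τ') f (Sum.elim b b') := by
    rintro (i | i)
    · exact h.2.1 i
    · exact h'.2.1 i
  have hjoin : JoinsRoots (pairNext τ τ') (fun j => Sum.elim b b' (id j))
      (fun j => Sum.elim b b' (Sum.map (· + m) (· + m') (id j))) f := by
    refine joinsRoots_pairNext (fun j z => ?_) (fun j z => ?_)
    · obtain ⟨t, ht⟩ := h.2.2 j z
      simp only [add_one_iterate] at ht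
      exact ⟨t, ht⟩
    · obtain ⟨t, ht⟩ := h'.2.2 j z
      simp only [add_one_iterate] at ht
      exact ⟨t, ht⟩
  have hnot : ¬ ((stateSet (Sum.elim b b')).card <
      (pairSet (Sum.map (· + m) (· + m')) (Sum.elim b b')).card ∨
      Function.Injective fun j => Sum.elim b b' (id j)) := fun h0 => hex ⟨h0, hmod, hjoin⟩
  rw [not_or, not_lt] at hnot
  obtain ⟨hle, hinj⟩ := hnot
  have hR : Function.Surjective (Sum.map (· + m) (· + m')) :=
    Sum.map_surjective.2 ⟨add_right_surjective m, add_right_surjective m'⟩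
  have hmeet : ∃ u u', b u = b' u' := by
    by_contra! hne
    exact hinj (h.1.sumElim h'.1 hne)
  obtain ⟨u, u', huu⟩ := hmeet
  refine ⟨u, u', fun k => ?_, ?_⟩
  · induction k with
    | zero => simpa using huu
    | succ k ih =>
      have := hmod.next_eq hR hle (i := Sum.inl (u + k)) (j := Sum.inr (u' + k)) ih
      push_cast
      rw [← add_assoc, ← add_assoc]
      exact this
  · exact right_eq_of_card_pairSet_le hle (i := Sum.inl u) (j := Sum.inr u') huu

/-- After `τ` steps the cycle `b` has closed, so `b'` has returned to its starting state too; by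
injectivity this happens only at multiples of `τ'`. -/
theorem dvd_of_common_rotation {τ' : ℕ} {b : ZMod τ → Fin n} {b' : ZMod τ' → Fin n}
    (h' : Function.Injective b') {u : ZMod τ} {u' : ZMod τ'}
    (h : ∀ k : ℕ, b (u + k) = b' (u' + k)) : τ' ∣ τ := by
  have h1 := h τ
  rw [ZMod.natCast_self, add_zero] at h1
  have h2 := h 0
  rw [Nat.cast_zero, Nat.cast_zero, add_zero, h1] at h2
  have h3 := h' h2
  rw [add_zero, add_eq_left] at h3
  exact (ZMod.natCast_eq_zero_iff τ τ').1 h3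

theorem IsGoodCycle.eq_rotate [NeZero τ] {m m' : ZMod τ} {f : CARule n} {b b' : ZMod τ → Fin n}
    (h : IsGoodCycle m f b) {u u' : ZMod τ}
    (hrot : ∀ k : ℕ, b (u + k) = b' (u' + k)) (hm : b (u + m) = b' (u' + m')) :
    m = m' ∧ ∃ c, b' = fun i => b (i + c) := by
  have hall : ∀ k : ZMod τ, b (u + k) = b' (u' + k) := by
    intro k
    obtain ⟨k, rfl⟩ := ZMod.natCast_zmod_surjective k
    exact hrot k
  refine ⟨?_, u - u', ?_⟩
  · rw [← hall] at hm
    exact add_left_cancel (h.1 hm)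
  · funext i
    have := hall (i - u')
    rw [add_sub_cancel] at this
    rw [← this]
    congr 1
    ring

-- Injectivity makes the `τ` prescribed arguments distinct, giving the factor `n^(-τ)`; the other
-- factor is the joining probability.
open Classical in
theorem card_isModel_joinsRoots_cycle [NeZero τ] (hn : 0 < n) (m : ZMod τ) {b : ZMod τ → Fin n}
    (hb : Function.Injective b) :
    ((Finset.univ.filter fun f : CARule n => IsGoodCycle m f b).card : ℝ) =
      (n : ℝ) ^ (n * n) / (n : ℝ) ^ τ * (1 - ((n - 1) / n : ℝ) ^ τ) := by
  have hn' : (0 : ℝ) < n := by exact_mod_cast hn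
  have hle : (pairSet (· + m) b).card ≤ (stateSet b).card := by
    rw [stateSet, Finset.card_image_of_injective _ hb]
    exact Finset.card_image_le
  have h1 := card_isModel_joinsRoots_eq hn (· + m) (· + 1) b (· + 1) id hb hle
  rw [det_one_sub_smul_phaseMatrix_zmod] at h1
  have h2 : ((Finset.univ.filter fun f : CARule n => IsModel (· + m) (· + 1) f b).card : ℝ) *
      (Fintype.card (Fin n) : ℝ) ^ Fintype.card (ZMod τ) =
      (Fintype.card (Fin n) : ℝ) ^ Fintype.card (Fin n × Fin n) := by
    rw [← card_filter_comp_eq (fun i => (b i, b (i + m)))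
      (fun i j hij => hb (congrArg Prod.fst hij)) (fun i => b (i + 1 + m))]
    congr 3
    ext f
    simp only [Finset.mem_filter, Finset.mem_univ, true_and]
    exact funext_iff.symm
  rw [Fintype.card_fin, ZMod.card, Fintype.card_prod, Fintype.card_fin] at h2
  rw [← h2, mul_div_cancel_right₀ _ (by positivity), ← h1]
  congr 2
  ext f
  simp only [Finset.mem_filter, Finset.mem_univ, true_and, IsGoodCycle, hb, id]

/-! ### Asymptotic number of good cycles. -/

theorem tendsto_mul_one_sub_pow (τ : ℕ) :
    Tendsto (fun n : ℕ => (n : ℝ) * (1 - ((n - 1) / n : ℝ) ^ τ)) atTop (nhds τ) := by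
  have hc : Tendsto (fun n : ℕ => ((n - 1) / n : ℝ)) atTop (nhds 1) := by
    have : Tendsto (fun n : ℕ => 1 - 1 / (n : ℝ)) atTop (nhds (1 - 0)) :=
      tendsto_const_nhds.sub tendsto_one_div_atTop_nhds_zero_nat
    rw [sub_zero] at this
    refine this.congr' ?_
    filter_upwards [eventually_gt_atTop 0] with n hn
    have : (n : ℝ) ≠ 0 := by positivity
    field_simp
  have hs : Tendsto (fun n : ℕ => ∑ i ∈ Finset.range τ, ((n - 1) / n : ℝ) ^ i) atTop
      (nhds (∑ _i ∈ Finset.range τ, (1 : ℝ))) :=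
    tendsto_finsetSum _ fun i _ => by simpa using hc.pow i
  simp only [Finset.sum_const, Finset.card_range, nsmul_eq_mul, mul_one] at hs
  refine hs.congr' ?_
  filter_upwards [eventually_gt_atTop 0] with n hn
  have hn' : (n : ℝ) ≠ 0 := by positivity
  rw [← mul_neg_geom_sum, ← mul_assoc]
  have : (n : ℝ) * (1 - (n - 1) / n) = 1 := by field_simp; ring
  rw [this, one_mul]

theorem tendsto_descFactorial_div_pow (τ : ℕ) :
    Tendsto (fun n : ℕ => (n.descFactorial τ : ℝ) / (n : ℝ) ^ τ) atTop (nhds 1) := by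
  induction τ with
  | zero => simp
  | succ τ ih =>
    have h1 : Tendsto (fun n : ℕ => 1 - (τ : ℝ) / n) atTop (nhds (1 - 0)) :=
      tendsto_const_nhds.sub (tendsto_const_div_atTop_nhds_zero_nat _)
    have h2 := h1.mul ih
    rw [sub_zero, one_mul] at h2
    refine h2.congr' ?_
    filter_upwards [eventually_gt_atTop 0, eventually_ge_atTop τ] with n hn hτ
    have hn' : (n : ℝ) ≠ 0 := by positivity
    rw [Nat.descFactorial_succ, Nat.cast_mul, Nat.cast_sub hτ, pow_succ]
    field_simp

open Classical in
/-- The expected number of good cycles up to rotation. -/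
theorem tendsto_goodCycle (τ : ℕ) [NeZero τ] (m : ZMod τ) :
    Tendsto (fun n : ℕ => (n : ℝ) * ((∑ f : CARule n,
      ((Finset.univ.filter fun b : ZMod τ → Fin n => IsGoodCycle m f b).card : ℝ) / τ) /
        (n : ℝ) ^ (n * n))) atTop (nhds 1) := by
  have hτ : (τ : ℝ) ≠ 0 := by exact_mod_cast NeZero.ne τ
  have hlim := ((tendsto_descFactorial_div_pow τ).mul (tendsto_mul_one_sub_pow τ)).div_const (τ : ℝ)
  rw [one_mul, div_self hτ] at hlim
  refine hlim.congr' ?_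
  filter_upwards [eventually_gt_atTop 0] with n hn
  have hn' : (n : ℝ) ≠ 0 := by positivity
  have hcount : ((Finset.univ.filter fun b : ZMod τ → Fin n => Function.Injective b).card : ℝ) =
      n.descFactorial τ := by
    rw [← Fintype.card_subtype, Fintype.card_congr (Equiv.subtypeInjectiveEquivEmbedding _ _),
      Fintype.card_embedding_eq, Fintype.card_fin, ZMod.card]
  have hsum : ∑ f : CARule n,
      ((Finset.univ.filter fun b : ZMod τ → Fin n => IsGoodCycle m f b).card : ℝ) =
      n.descFactorial τ * ((n : ℝ) ^ (n * n) / (n : ℝ) ^ τ * (1 - ((n - 1) / n : ℝ) ^ τ)) := by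
    have hswap : ∑ f : CARule n,
        ((Finset.univ.filter fun b : ZMod τ → Fin n => IsGoodCycle m f b).card : ℝ) =
        ∑ b : ZMod τ → Fin n,
          ((Finset.univ.filter fun f : CARule n => IsGoodCycle m f b).card : ℝ) := by
      simp only [Finset.card_filter, Nat.cast_sum]
      exact Finset.sum_comm
    rw [hswap, ← hcount, ← nsmul_eq_mul, ← Finset.sum_const, Finset.sum_filter]
    refine Finset.sum_congr rfl fun b _ => ?_
    split_ifs with hb
    · exact card_isModel_joinsRoots_cycle hn m hb
    · rw [Nat.cast_eq_zero, Finset.card_eq_zero, Finset.filter_eq_empty_iff]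
      exact fun f _ hf => hb hf.1
  rw [← Finset.sum_div, hsum]
  field_simp

end GoodCycle

/-! ### The structure of weakly robust periodic solutions -/

section Tile

variable {n τ σ : ℕ}

/-- The right neighbor in a tile. -/
abbrev tileRight (τ σ : ℕ) (p : ZMod τ × ZMod σ) : ZMod τ × ZMod σ := (p.1, p.2 + 1)

/-- The successor in time in a tile. -/
abbrev tileNext (τ σ : ℕ) (p : ZMod τ × ZMod σ) : ZMod τ × ZMod σ := (p.1 + 1, p.2)

/-- Two adjacent columns of a tile. -/
abbrev tileColumns (τ σ : ℕ) : ZMod τ ⊕ ZMod τ → ZMod τ × ZMod σ :=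
  Sum.elim (fun t => (t, 0)) (fun t => (t, 1))

theorem tileRight_surjective (τ σ : ℕ) : Function.Surjective (tileRight τ σ) :=
  fun p => ⟨(p.1, p.2 - 1), by simp [tileRight]⟩

theorem evolve_add {f : CARule n} (ξ : CAConfig n) (s t : ℕ) :
    f.evolve ξ (s + t) = f.evolve (f.evolve ξ t) s :=
  Function.iterate_add_apply _ _ _ _

theorem evolve_mod {f : CARule n} {ξ : CAConfig n} (h : f.evolve ξ τ = ξ) (t : ℕ) :
    f.evolve ξ (t % τ) = f.evolve ξ t := by
  have hp : Function.Periodic (f.evolve ξ) τ := fun t => by rw [evolve_add, h]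
  exact hp.map_mod_nat t

theorem evolve_periodic {f : CARule n} {ξ : CAConfig n} (h : ∀ x : ℤ, ξ x = ξ (x + σ)) (t : ℕ) :
    Function.Periodic (f.evolve ξ t) (σ : ℤ) := by
  induction t with
  | zero => exact fun x => (h x).symm
  | succ t ih =>
    intro x
    rw [evolve_succ_apply, evolve_succ_apply, ih x, ← ih (x - 1)]
    congr 3
    ring

/-- The space-time configuration of a periodic solution as a labelling of a torus. -/
def tile (f : CARule n) (ξ : CAConfig n) (p : ZMod τ × ZMod σ) : Fin n :=
  f.evolve ξ p.1.val (p.2.val : ℤ)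

theorem tile_cast [NeZero τ] [NeZero σ] {f : CARule n} {ξ : CAConfig n}
    (hs : ∀ x : ℤ, ξ x = ξ (x + σ)) (ht : f.evolve ξ τ = ξ) (t : ℕ) (x : ℤ) :
    tile f ξ ((t : ZMod τ), (x : ZMod σ)) = f.evolve ξ t x := by
  unfold tile
  simp only [ZMod.val_natCast, ZMod.val_intCast]
  rw [evolve_mod ht]
  have h := (evolve_periodic (f := f) hs t).int_mul (x / σ) (x % σ)
  rw [Int.cast_id, Int.emod_add_ediv_mul] at h
  exact h.symm

/-- In a tile with as many pairs as states, equality of states is translation invariant. -/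
theorem tile_translate [NeZero τ] [NeZero σ] {f : CARule n} {η : ZMod τ × ZMod σ → Fin n}
    (hf : IsModel (tileRight τ σ) (tileNext τ σ) f η)
    (hle : (pairSet (tileRight τ σ) η).card ≤ (stateSet η).card)
    {p q : ZMod τ × ZMod σ} (hpq : η p = η q) (g : ZMod τ × ZMod σ) : η (p + g) = η (q + g) := by
  obtain ⟨gt, gx⟩ := g
  obtain ⟨k, rfl⟩ := ZMod.natCast_zmod_surjective gt
  obtain ⟨l, rfl⟩ := ZMod.natCast_zmod_surjective gx
  induction k with
  | zero =>
    induction l with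
    | zero => simpa only [Nat.cast_zero, ← Prod.zero_eq_mk, add_zero] using hpq
    | succ l ih =>
      have := right_eq_of_card_pairSet_le hle ih
      simpa [tileRight, Prod.add_def, add_assoc] using this
  | succ k ih =>
    have := hf.next_eq (tileRight_surjective τ σ) hle ih
    simpa [tileNext, Prod.add_def, add_assoc] using this

/-- The tile of a weakly robust periodic solution is exceptional, or it is generated by a good
cycle. -/
theorem exists_goodCycle_or_isExceptional [NeZero τ] [NeZero σ] {f : CARule n} {ξ : CAConfig n}
    (hξ : IsPeriodicSolution f τ σ ξ) (hv : 0 < expansionVelocity f ξ) :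
    (∃ m : ZMod τ, addOrderOf m = σ ∧ ∃ b, IsGoodCycle m f b) ∨
      ∃ η, IsExceptional (tileRight τ σ) (tileNext τ σ) (tileColumns τ σ) f η := by
  obtain ⟨⟨⟨hσ0, hσ⟩, hσmin⟩, ⟨hτ0, hτ⟩, hτmin⟩ := hξ
  set η : ZMod τ × ZMod σ → Fin n := tile f ξ with hη
  have hcast : ∀ (t : ℕ) (x : ℤ), η ((t : ZMod τ), (x : ZMod σ)) = f.evolve ξ t x :=
    tile_cast hσ hτ
  have hmod : IsModel (tileRight τ σ) (tileNext τ σ) f η := by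
    rintro ⟨t, x⟩
    obtain ⟨t, rfl⟩ := ZMod.natCast_zmod_surjective t
    obtain ⟨x, rfl⟩ := ZMod.intCast_surjective x
    have h1 := hcast t (x + 1)
    have h2 := hcast (t + 1) (x + 1)
    push_cast at h1 h2
    simp only [tileRight]
    rw [hcast, h1, h2, evolve_succ_apply, add_sub_cancel_right]
  have hcol : ∀ (x : ℤ) (t₀ : ZMod τ) (z : Fin n), ∃ t : ℕ,
      walk f (fun i => η (t₀ + i, (x : ZMod σ))) z t = η (t₀ + t, (x : ZMod σ) + 1) := by
    intro x t₀ z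
    obtain ⟨t₀, rfl⟩ := ZMod.natCast_zmod_surjective t₀
    -- After `r` steps the phase `t₀` has advanced to `0`, where the joining property of walks
    -- started at time zero applies.
    set r := t₀ * (τ - 1) with hr
    have hr0 : (t₀ : ZMod τ) + (r : ZMod τ) = 0 := by
      have : t₀ + r = t₀ * τ := by
        obtain ⟨k, hk⟩ := Nat.exists_eq_succ_of_ne_zero hτ0.ne'
        rw [hr, hk, Nat.succ_sub_one, Nat.mul_succ, add_comm]
      rw [← Nat.cast_add, this]
      simp
    obtain ⟨t, ht⟩ := exists_walk_eq_of_expansionVelocity_pos hv x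
      (walk f (fun i => η ((t₀ : ZMod τ) + i, (x : ZMod σ))) z r)
    refine ⟨r + t, ?_⟩
    rw [walk_add]
    have hphase : ∀ i : ℕ, (t₀ : ZMod τ) + ((r + i : ℕ) : ZMod τ) = i := by
      intro i
      rw [Nat.cast_add, ← add_assoc, hr0, zero_add]
    have h1 := hcast t (x + 1)
    push_cast at h1
    simp only [hphase, hcast, h1]
    exact ht
  have hjoin : JoinsRoots (pairNext τ τ) (fun j => η (tileColumns τ σ j))
      (fun j => η (tileRight τ σ (tileColumns τ σ j))) f := by
    refine joinsRoots_pairNext (fun j z => ?_) (fun j z => ?_)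
    · simpa [tileRight] using hcol 0 j z
    · simpa [tileRight] using hcol 1 j z
  by_cases hexc : (stateSet η).card < (pairSet (tileRight τ σ) η).card ∨
      Function.Injective fun j => η (tileColumns τ σ j)
  · exact Or.inr ⟨η, hexc, hmod, hjoin⟩
  left
  rw [not_or, not_lt] at hexc
  obtain ⟨hle, hninj⟩ := hexc
  have htr : ∀ {p q : ZMod τ × ZMod σ}, η p = η q → ∀ g, η (p + g) = η (q + g) :=
    fun hpq g => tile_translate hmod hle hpq g
  -- By translation invariance a repetition within one column yields a temporal period of the whole
  -- solution, so minimality of `τ` excludes it.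
  have htime : ∀ t t' x, η (t, x) = η (t', x) → t = t' := by
    intro t t' x heq
    have hd : ∀ y : ZMod σ, η (0, y) = η (t' - t, y) := by
      intro y
      have := htr heq (-t, y - x)
      simpa [sub_eq_add_neg] using this
    have hper : f.evolve ξ (t' - t).val = ξ := by
      funext x
      have h1 := hd x
      have h2 := hcast 0 x
      have h3 := hcast (t' - t).val x
      rw [ZMod.natCast_zmod_val] at h3
      rw [Nat.cast_zero] at h2
      rw [← h3, ← h1, h2]
      rfl
    by_contra hne
    have hpos : 0 < (t' - t).val := by
      rw [Nat.pos_iff_ne_zero, ne_eq, ZMod.val_eq_zero, sub_eq_zero]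
      exact fun h => hne h.symm
    exact absurd (hτmin ⟨hpos, hper⟩) (not_le.2 (ZMod.val_lt _))
  obtain ⟨t, t', htt⟩ : ∃ t t', η (t, 0) = η (t', 1) := by
    by_contra! hne
    refine hninj ?_
    rintro (i | i) (j | j) hij
    · exact congrArg Sum.inl (htime i j 0 hij)
    · exact absurd hij (hne i j)
    · exact absurd hij.symm (hne j i)
    · exact congrArg Sum.inr (htime i j 1 hij)
  -- Both columns are injective, so a repetition must be a state they share. Translating this
  -- coincidence makes column `1` the time shift of column `0` by `m`, and likewise for every
  -- further column.
  set m := t - t' with hm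
  have hshift : ∀ k y, η (k, y + 1) = η (k + m, y) := by
    intro k y
    have := htr htt (k - t', y)
    simp only [Prod.mk_add_mk, zero_add] at this
    rw [show k + m = t + (k - t') by rw [hm]; ring, this, add_comm 1 y, add_sub_cancel]
  have hb : ∀ (x : ℕ) k, η (k, (x : ZMod σ)) = η (k + x * m, 0) := by
    intro x
    induction x with
    | zero => simp
    | succ x ih =>
      intro k
      rw [Nat.cast_succ, hshift, ih]
      congr 2
      push_cast
      ring
  have hbm : ∀ k, η (k + m, 0) = η (k, 1) := fun k => by
    rw [← hshift, zero_add]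
  refine ⟨m, le_antisymm ?_ ?_, fun k => η (k, 0), ?_, ?_, ?_⟩
  · refine Nat.le_of_dvd hσ0 (addOrderOf_dvd_of_nsmul_eq_zero ?_)
    have h1 := hb σ 0
    rw [ZMod.natCast_self, zero_add] at h1
    rw [nsmul_eq_mul]
    exact (htime _ _ _ h1).symm
  · refine hσmin ⟨addOrderOf_pos m, fun x => ?_⟩
    have h1 := hcast 0 x
    have h2 := hcast 0 (x + (addOrderOf m : ℕ))
    obtain ⟨a, ha⟩ := ZMod.natCast_zmod_surjective (x : ZMod σ)
    have h0 : ((addOrderOf m : ℕ) : ZMod τ) * m = 0 := by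
      rw [← nsmul_eq_mul]
      exact addOrderOf_nsmul_eq_zero m
    push_cast at h1 h2
    rw [← ha, hb] at h1
    rw [← ha, ← Nat.cast_add, hb, Nat.cast_add, add_mul, h0, add_zero] at h2
    exact h1.symm.trans h2
  · exact fun i j hij => htime i j 0 hij
  · intro i
    have := hmod (i, 0)
    simp only [tileRight, zero_add] at this
    simp only [hbm]
    exact this
  · intro j z
    obtain ⟨t, ht⟩ := hcol 0 j z
    refine ⟨t, ?_⟩
    simp only [add_one_iterate, hbm]
    simpa using ht

end Tile

/-! ### First and second moments -/

section Moments

variable {n : ℕ} {T S : Finset ℕ}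

/-- The types of good cycles that generate solutions with periods in `T × S`. -/
abbrev CycleType (T S : Finset ℕ) : Type := Σ τ : T, {m : ZMod τ // addOrderOf m ∈ S}

variable [∀ τ : T, NeZero (τ : ℕ)]

open Classical in
/-- The number of good cycles up to rotation. -/
noncomputable def cycleCount (T S : Finset ℕ) [∀ τ : T, NeZero (τ : ℕ)] (f : CARule n) : ℝ :=
  ∑ θ : CycleType T S,
    ((Finset.univ.filter fun b : ZMod θ.1 → Fin n => IsGoodCycle θ.2.1 f b).card : ℝ) / (θ.1 : ℕ)

open Classical in
/-- The number of exceptional pairs of cycles. -/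
noncomputable def pairCount (T S : Finset ℕ) [∀ τ : T, NeZero (τ : ℕ)] (f : CARule n) : ℝ :=
  ∑ θ : CycleType T S, ∑ θ' : CycleType T S,
    ((Finset.univ.filter fun η : ZMod θ.1 ⊕ ZMod θ'.1 → Fin n =>
      IsExceptional (Sum.map (· + θ.2.1) (· + θ'.2.1)) (pairNext θ.1 θ'.1) id f η).card : ℝ)

open Classical in
/-- The number of exceptional tiles. -/
noncomputable def tileCount (T S : Finset ℕ) [∀ τ : T, NeZero (τ : ℕ)]
    [∀ σ : S, NeZero (σ : ℕ)] (f : CARule n) : ℝ :=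
  ∑ τ : T, ∑ σ : S,
    ((Finset.univ.filter fun η : ZMod τ × ZMod σ → Fin n =>
      IsExceptional (tileRight τ σ) (tileNext τ σ) (tileColumns τ σ) f η).card : ℝ)

-- The `τ` rotations of an injective cycle are distinct good cycles, so dividing by `τ` in
-- `cycleCount` leaves at least one.
open Classical in
theorem IsGoodCycle.le_card {τ : ℕ} [NeZero τ] {m : ZMod τ} {f : CARule n} {b : ZMod τ → Fin n}
    (h : IsGoodCycle m f b) :
    τ ≤ (Finset.univ.filter fun b : ZMod τ → Fin n => IsGoodCycle m f b).card := by
  have hinj : Function.Injective fun (c : ZMod τ) (i : ZMod τ) => b (i + c) := by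
    intro c c' hcc
    exact add_left_cancel (h.1 (congrFun hcc 0))
  have := Finset.card_le_card_of_injOn (s := (Finset.univ : Finset (ZMod τ)))
    (t := Finset.univ.filter fun b : ZMod τ → Fin n => IsGoodCycle m f b) _
    (fun c _ => Finset.mem_coe.2 (Finset.mem_filter.2 ⟨Finset.mem_univ _, h.rotate c⟩))
    (hinj.injOn)
  rwa [Finset.card_univ, ZMod.card] at this

theorem one_le_cycleCount {f : CARule n} (θ : CycleType T S) {b : ZMod θ.1 → Fin n}
    (h : IsGoodCycle θ.2.1 f b) : 1 ≤ cycleCount T S f := by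
  classical
  unfold cycleCount
  refine le_trans ?_ (Finset.single_le_sum
    (f := fun θ : CycleType T S => ((Finset.univ.filter fun b : ZMod θ.1 → Fin n =>
      IsGoodCycle θ.2.1 f b).card : ℝ) / (θ.1 : ℕ)) (fun _ _ => by positivity)
    (Finset.mem_univ θ))
  have hpos : (0 : ℝ) < (θ.1 : ℕ) := by exact_mod_cast Nat.pos_of_ne_zero (NeZero.ne (θ.1 : ℕ))
  rw [le_div_iff₀ hpos, one_mul]
  exact_mod_cast h.le_card

theorem cycleCount_nonneg (f : CARule n) : 0 ≤ cycleCount T S f := by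
  classical
  exact Finset.sum_nonneg fun _ _ => by positivity

theorem tileCount_nonneg [∀ σ : S, NeZero (σ : ℕ)] (f : CARule n) : 0 ≤ tileCount T S f := by
  classical
  exact Finset.sum_nonneg fun _ _ => Finset.sum_nonneg fun _ _ => by positivity

theorem exists_goodCycle_of_cycleCount_ne_zero {f : CARule n} (h : cycleCount T S f ≠ 0) :
    ∃ (θ : CycleType T S) (b : ZMod θ.1 → Fin n), IsGoodCycle θ.2.1 f b := by
  classical
  obtain ⟨θ, -, hθ⟩ := Finset.exists_ne_zero_of_sum_ne_zero h
  have h1 : (Finset.univ.filter fun b : ZMod θ.1 → Fin n => IsGoodCycle θ.2.1 f b).card ≠ 0 := by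
    intro h0
    rw [h0] at hθ
    simp at hθ
  obtain ⟨b, hb⟩ := Finset.card_ne_zero.1 h1
  exact ⟨θ, b, (Finset.mem_filter.1 hb).2⟩

theorem wrps_nonempty_of_goodCycle {f : CARule n} (θ : CycleType T S) {b : ZMod θ.1 → Fin n}
    (h : IsGoodCycle θ.2.1 f b) : (WRPS f T S).Nonempty :=
  ⟨_, θ.1, θ.1.2, _, θ.2.2, h.isPeriodicSolution, h.expansionVelocity_pos⟩

theorem one_le_tileCount [∀ σ : S, NeZero (σ : ℕ)] {f : CARule n} (τ : T) (σ : S)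
    {η : ZMod τ × ZMod σ → Fin n}
    (h : IsExceptional (tileRight τ σ) (tileNext τ σ) (tileColumns τ σ) f η) :
    1 ≤ tileCount T S f := by
  classical
  let E : T → S → ℝ := fun τ σ => ((Finset.univ.filter fun η : ZMod τ × ZMod σ → Fin n =>
    IsExceptional (tileRight τ σ) (tileNext τ σ) (tileColumns τ σ) f η).card : ℝ)
  have hE : ∀ τ σ, 0 ≤ E τ σ := fun τ σ => Nat.cast_nonneg _
  have h1 : (1 : ℝ) ≤ E τ σ := by
    have h0 : 0 < (Finset.univ.filter fun η : ZMod τ × ZMod σ → Fin n =>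
        IsExceptional (tileRight τ σ) (tileNext τ σ) (tileColumns τ σ) f η).card :=
      Finset.card_pos.2 ⟨η, Finset.mem_filter.2 ⟨Finset.mem_univ _, h⟩⟩
    exact Nat.one_le_cast.2 h0
  calc (1 : ℝ) ≤ E τ σ := h1
    _ ≤ ∑ σ, E τ σ := Finset.single_le_sum (fun σ _ => hE τ σ) (Finset.mem_univ σ)
    _ ≤ ∑ τ, ∑ σ, E τ σ := Finset.single_le_sum (f := fun τ => ∑ σ, E τ σ)
        (fun τ _ => Finset.sum_nonneg fun σ _ => hE τ σ) (Finset.mem_univ τ)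
    _ = tileCount T S f := rfl

theorem one_le_of_wrps_nonempty [∀ σ : S, NeZero (σ : ℕ)] {f : CARule n}
    (h : (WRPS f T S).Nonempty) : 1 ≤ cycleCount T S f + tileCount T S f := by
  obtain ⟨ξ, τ, hτ, σ, hσ, hξ, hv⟩ := h
  lift τ to T using hτ
  lift σ to S using hσ
  rcases exists_goodCycle_or_isExceptional hξ hv with ⟨m, hm, b, hb⟩ | ⟨η, hη⟩
  · have := one_le_cycleCount (T := T) (S := S) ⟨τ, m, by rw [hm]; exact σ.2⟩ hb
    linarith [tileCount_nonneg (T := T) (S := S) f]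
  · linarith [cycleCount_nonneg (T := T) (S := S) f, one_le_tileCount τ σ hη]

open Classical in
/-- Pairs of good cycles are rotations of each other or exceptional. -/
theorem card_mul_card_le (f : CARule n) (θ θ' : CycleType T S) :
    (Finset.univ.filter fun b : ZMod θ.1 → Fin n => IsGoodCycle θ.2.1 f b).card *
      (Finset.univ.filter fun b : ZMod θ'.1 → Fin n => IsGoodCycle θ'.2.1 f b).card ≤
    (if θ = θ' then
      (Finset.univ.filter fun b : ZMod θ.1 → Fin n => IsGoodCycle θ.2.1 f b).card * θ.1 else 0) +
    (Finset.univ.filter fun η : ZMod θ.1 ⊕ ZMod θ'.1 → Fin n =>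
      IsExceptional (Sum.map (· + θ.2.1) (· + θ'.2.1)) (pairNext θ.1 θ'.1) id f η).card := by
  set G := Finset.univ.filter fun b : ZMod θ.1 → Fin n => IsGoodCycle θ.2.1 f b with hG
  set G' := Finset.univ.filter fun b : ZMod θ'.1 → Fin n => IsGoodCycle θ'.2.1 f b with hG'
  set P : (ZMod θ.1 → Fin n) × (ZMod θ'.1 → Fin n) → Prop := fun p =>
    IsExceptional (Sum.map (· + θ.2.1) (· + θ'.2.1)) (pairNext θ.1 θ'.1) id f (Sum.elim p.1 p.2)
    with hP
  rw [← Finset.card_product, ← Finset.card_filter_add_card_filter_not (s := G ×ˢ G') P, add_comm]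
  refine add_le_add ?_ ?_
  · have hrot : ∀ p ∈ (G ×ˢ G').filter fun p => ¬ P p, ∃ u u',
        (∀ k : ℕ, p.1 (u + k) = p.2 (u' + k)) ∧ p.1 (u + θ.2.1) = p.2 (u' + θ'.2.1) := by
      intro p hp
      obtain ⟨hp1, hp2⟩ := Finset.mem_filter.1 hp
      obtain ⟨h1, h2⟩ := Finset.mem_product.1 hp1
      exact (Finset.mem_filter.1 h1).2.exists_common_rotation (Finset.mem_filter.1 h2).2 hp2
    split_ifs with heq
    · subst heq
      calc _ ≤ ((G ×ˢ (Finset.univ : Finset (ZMod θ.1))).image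
            fun q => (q.1, fun i => q.1 (i + q.2))).card := by
            refine Finset.card_le_card fun p hp => ?_
            obtain ⟨u, u', h1, h2⟩ := hrot p hp
            have hg := (Finset.mem_product.1 (Finset.mem_filter.1 hp).1).1
            obtain ⟨-, c, hc⟩ := (Finset.mem_filter.1 hg).2.eq_rotate h1 h2
            refine Finset.mem_image.2 ⟨(p.1, c), Finset.mem_product.2 ⟨hg, Finset.mem_univ _⟩, ?_⟩
            exact Prod.ext rfl hc.symm
        _ ≤ (G ×ˢ (Finset.univ : Finset (ZMod θ.1))).card := Finset.card_image_le
        _ = _ := by rw [Finset.card_product, Finset.card_univ, ZMod.card]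
    · rw [Nat.le_zero, Finset.card_eq_zero, Finset.eq_empty_iff_forall_notMem]
      intro p hp
      obtain ⟨u, u', h1, h2⟩ := hrot p hp
      obtain ⟨hg, hg'⟩ := Finset.mem_product.1 (Finset.mem_filter.1 hp).1
      have hb := (Finset.mem_filter.1 hg).2
      have hb' := (Finset.mem_filter.1 hg').2
      have hd1 := dvd_of_common_rotation hb'.1 h1
      have hd2 := dvd_of_common_rotation hb.1 fun k => (h1 k).symm
      clear hp hrot hg hg' hG hG' hP
      clear P G G'
      obtain ⟨⟨τ, hτ⟩, ⟨m, hm⟩⟩ := θ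
      obtain ⟨⟨τ', hτ'⟩, ⟨m', hm'⟩⟩ := θ'
      obtain rfl : τ = τ' := Nat.dvd_antisymm hd2 hd1
      obtain ⟨rfl, -⟩ := hb.eq_rotate h1 h2
      exact heq rfl
  · refine Finset.card_le_card_of_injOn (fun p => Sum.elim p.1 p.2) (fun p hp => ?_) ?_
    · exact Finset.mem_coe.2
        (Finset.mem_filter.2 ⟨Finset.mem_univ _, (Finset.mem_filter.1 hp).2⟩)
    · intro p _ q _ hpq
      exact Prod.ext (funext fun i => congrFun hpq (Sum.inl i))
        (funext fun i => congrFun hpq (Sum.inr i))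

/-- Expanding the square counts ordered pairs of cycles. Rotations of the same cycle give back
`cycleCount` after normalization; all other pairs are exceptional. -/
theorem cycleCount_sq_le (f : CARule n) :
    cycleCount T S f ^ 2 ≤ cycleCount T S f + pairCount T S f := by
  classical
  have hone : ∀ θ : CycleType T S, (1 : ℝ) ≤ (θ.1 : ℕ) := fun θ => by
    exact_mod_cast Nat.pos_of_ne_zero (NeZero.ne (θ.1 : ℕ))
  set A : CycleType T S → ℝ := fun θ =>
    ((Finset.univ.filter fun b : ZMod θ.1 → Fin n => IsGoodCycle θ.2.1 f b).card : ℝ) with hA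
  set E : CycleType T S → CycleType T S → ℝ := fun θ θ' =>
    ((Finset.univ.filter fun η : ZMod θ.1 ⊕ ZMod θ'.1 → Fin n =>
      IsExceptional (Sum.map (· + θ.2.1) (· + θ'.2.1)) (pairNext θ.1 θ'.1) id f η).card : ℝ)
    with hE
  have hpt : ∀ θ θ', A θ / (θ.1 : ℕ) * (A θ' / (θ'.1 : ℕ)) ≤
      (if θ = θ' then A θ / (θ.1 : ℕ) else 0) + E θ θ' := by
    intro θ θ'
    have h1 : A θ * A θ' ≤ (if θ = θ' then A θ * (θ.1 : ℕ) else 0) + E θ θ' := by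
      have := card_mul_card_le f θ θ'
      simp only [hA, hE]
      split_ifs with heq
      · rw [if_pos heq] at this
        exact_mod_cast this
      · rw [if_neg heq] at this
        exact_mod_cast this
    have hE0 : 0 ≤ E θ θ' := by positivity
    have hθ := hone θ
    have hθ' := hone θ'
    rw [div_mul_div_comm, div_le_iff₀ (by positivity)]
    refine h1.trans ?_
    rw [add_mul]
    refine add_le_add ?_ ?_
    · split_ifs with heq
      · subst heq
        refine le_of_eq ?_
        field_simp
      · simp
    · exact le_mul_of_one_le_right hE0 (one_le_mul_of_one_le_of_one_le hθ hθ')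
  calc cycleCount T S f ^ 2 = ∑ θ, ∑ θ', A θ / (θ.1 : ℕ) * (A θ' / (θ'.1 : ℕ)) := by
        rw [sq, cycleCount, Finset.sum_mul_sum]
    _ ≤ ∑ θ, ∑ θ', ((if θ = θ' then A θ / (θ.1 : ℕ) else 0) + E θ θ') :=
        Finset.sum_le_sum fun θ _ => Finset.sum_le_sum fun θ' _ => hpt θ θ'
    _ = _ := by
        simp only [Finset.sum_add_distrib, Finset.sum_ite_eq, Finset.mem_univ, if_true]
        rfl

theorem tendsto_sum_cycleCount :
    Tendsto (fun n : ℕ => (n : ℝ) * ((∑ f : CARule n, cycleCount T S f) / (n : ℝ) ^ (n * n)))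
      atTop (nhds (Fintype.card (CycleType T S))) := by
  classical
  have h := tendsto_finsetSum (Finset.univ : Finset (CycleType T S))
    fun θ _ => tendsto_goodCycle θ.1 θ.2.1
  simp only [Finset.sum_const, Finset.card_univ, nsmul_eq_mul, mul_one] at h
  refine h.congr fun n => ?_
  simp only [cycleCount]
  rw [Finset.sum_comm, Finset.sum_div, Finset.mul_sum]

theorem tendsto_sum_pairCount :
    Tendsto (fun n : ℕ => (n : ℝ) * ((∑ f : CARule n, pairCount T S f) / (n : ℝ) ^ (n * n)))
      atTop (nhds 0) := by
  classical
  have h := tendsto_finsetSum (Finset.univ : Finset (CycleType T S × CycleType T S)) fun p _ =>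
    tendsto_exceptional (Sum.map (· + p.1.2.1) (· + p.2.2.1)) (pairNext p.1.1 p.2.1) p.1.1 p.2.1 id
  simp only [Finset.sum_const_zero] at h
  refine h.congr fun n => ?_
  simp only [pairCount]
  rw [← Finset.mul_sum, ← Finset.sum_div, Finset.sum_comm]
  simp only [Fintype.sum_prod_type]

theorem tendsto_sum_tileCount [∀ σ : S, NeZero (σ : ℕ)] :
    Tendsto (fun n : ℕ => (n : ℝ) * ((∑ f : CARule n, tileCount T S f) / (n : ℝ) ^ (n * n)))
      atTop (nhds 0) := by
  classical
  have h := tendsto_finsetSum (Finset.univ : Finset (T × S)) fun p _ =>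
    tendsto_exceptional (tileRight p.1 p.2) (tileNext p.1 p.2) p.1 p.1 (tileColumns p.1 p.2)
  simp only [Finset.sum_const_zero] at h
  refine h.congr fun n => ?_
  simp only [tileCount]
  rw [← Finset.mul_sum, ← Finset.sum_div, Finset.sum_comm]
  simp only [Fintype.sum_prod_type]

open Classical in
theorem probWRPS_eq (T S : Finset ℕ) (n : ℕ) :
    probWRPS T S n = (∑ f : CARule n, if (WRPS f T S).Nonempty then (1 : ℝ) else 0) /
      (n : ℝ) ^ (n * n) := by
  rw [probWRPS, MeasureTheory.measureReal_def, uniformOn_univ, ENNReal.toReal_div,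
    MeasureTheory.Measure.count_apply (Set.toFinite _).measurableSet]
  have h : {f : CARule n | (WRPS f T S).Nonempty} =
      ((Finset.univ.filter fun f : CARule n => (WRPS f T S).Nonempty : Finset (CARule n)) :
        Set (CARule n)) := by
    ext f
    simp
  rw [h, Set.encard_coe_eq_coe_finsetCard, Finset.sum_boole]
  simp

/-- Both bounds hold rule by rule. For the lower one, with `N` the cycle count and `P` the pair
count, `N² ≤ N + P` gives `N - P ≤ 2N - N² ≤ 1`, and `N = 0` when the rule has no solution. -/
theorem probWRPS_bounds [∀ σ : S, NeZero (σ : ℕ)] (n : ℕ) :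
    (∑ f : CARule n, cycleCount T S f) / (n : ℝ) ^ (n * n) -
        (∑ f : CARule n, pairCount T S f) / (n : ℝ) ^ (n * n) ≤ probWRPS T S n ∧
      probWRPS T S n ≤ (∑ f : CARule n, cycleCount T S f) / (n : ℝ) ^ (n * n) +
        (∑ f : CARule n, tileCount T S f) / (n : ℝ) ^ (n * n) := by
  classical
  rw [probWRPS_eq, ← sub_div, ← add_div, ← Finset.sum_sub_distrib, ← Finset.sum_add_distrib]
  constructor
  · gcongr with f
    have hsq := cycleCount_sq_le (T := T) (S := S) f
    split_ifs with hW
    · nlinarith [sq_nonneg (cycleCount T S f - 1)]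
    · have h0 : cycleCount T S f = 0 := by
        by_contra hne
        obtain ⟨θ, b, hb⟩ := exists_goodCycle_of_cycleCount_ne_zero hne
        exact hW (wrps_nonempty_of_goodCycle θ hb)
      rw [h0] at hsq ⊢
      linarith
  · gcongr with f
    split_ifs with hW
    · exact one_le_of_wrps_nonempty hW
    · exact add_nonneg (cycleCount_nonneg f) (tileCount_nonneg f)

theorem tendsto_mul_probWRPS [∀ σ : S, NeZero (σ : ℕ)] :
    Tendsto (fun n : ℕ => (n : ℝ) * probWRPS T S n) atTop
      (nhds (Fintype.card (CycleType T S))) := by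
  have hl := (tendsto_sum_cycleCount (T := T) (S := S)).sub
    (tendsto_sum_pairCount (T := T) (S := S))
  have hu := (tendsto_sum_cycleCount (T := T) (S := S)).add
    (tendsto_sum_tileCount (T := T) (S := S))
  rw [sub_zero] at hl
  rw [add_zero] at hu
  refine tendsto_of_tendsto_of_tendsto_of_le_of_le hl hu (fun n => ?_) (fun n => ?_)
  · simp only
    rw [← mul_sub]
    exact mul_le_mul_of_nonneg_left (probWRPS_bounds n).1 n.cast_nonneg
  · simp only
    rw [← mul_add]
    exact mul_le_mul_of_nonneg_left (probWRPS_bounds n).2 n.cast_nonneg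

end Moments

theorem theorem1 (T S : Finset ℕ) (hT : ∀ τ ∈ T, 0 < τ) (hS : ∀ σ ∈ S, 0 < σ)
    (hdvd : ∃ τ ∈ T, ∃ σ ∈ S, σ ∣ τ) :
    ∃ c : ℝ, 0 < c ∧
      (fun n : ℕ => probWRPS T S n - c / (n : ℝ)) =o[atTop] (fun n : ℕ => 1 / (n : ℝ)) := by
  have : ∀ τ : T, NeZero (τ : ℕ) := fun τ => ⟨(hT τ τ.2).ne'⟩
  have : ∀ σ : S, NeZero (σ : ℕ) := fun σ => ⟨(hS σ σ.2).ne'⟩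
  refine ⟨Fintype.card (CycleType T S), ?_, ?_⟩
  · obtain ⟨τ, hτ, σ, hσ, k, hk⟩ := hdvd
    have hk0 : k ≠ 0 := by
      rintro rfl
      exact (hT τ hτ).ne' (by simpa using hk)
    -- With `τ = σ * k`, the residue `k` is a shift of order `σ`, so there is at least one cycle
    -- type and the constant is positive.
    have horder : addOrderOf (k : ZMod τ) = σ := by
      rw [ZMod.addOrderOf_coe k (hT τ hτ).ne', hk, Nat.gcd_mul_left_left,
        Nat.mul_div_cancel _ (Nat.pos_of_ne_zero hk0)]
    have : Nonempty (CycleType T S) := ⟨⟨τ, hτ⟩, (k : ZMod τ), by rw [horder]; exact hσ⟩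
    exact_mod_cast Fintype.card_pos
  · rw [isLittleO_iff_tendsto']
    · have h := (tendsto_mul_probWRPS (T := T) (S := S)).sub_const
        (Fintype.card (CycleType T S) : ℝ)
      rw [sub_self] at h
      refine h.congr' ?_
      filter_upwards [eventually_gt_atTop 0] with n hn
      have hn' : (n : ℝ) ≠ 0 := by positivity
      field_simp
    · filter_upwards [eventually_gt_atTop 0] with n hn h0
      have hn' : (n : ℝ) ≠ 0 := by positivity
      exact absurd h0 (one_div_ne_zero hn')
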